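/- Let $g(x)=\cot(\pi x)$, $\alpha=(\sqrt5-1)/2$, and let $p_n/q_n=F_{n-1}/F_n$ ($F_n$ the Fibonacci numbers) be the convergents of $\alpha$. For $x\in[0,1)$ put $$s(x,y)=\lim_{n\to\infty}\frac1{q_{2n}}\sum_{k=1}^{[q_{2n}x]}g\Big(\frac{y}{q_{2n}}+k\alpha\Big),\qquad t(x,y)=\lim_{n\to\infty}\frac1{q_{2n}}\sum_{k=1}^{[q_{2n}x]}g\Big(\frac{y}{q_{2n}}+k\frac{p_{2n}}{q_{2n}}\Big).$$ Suppose that for some $r>0$ the limit $s(x,y)$ exists for all $x\in[0,1)$ and $|y|<r$, and that $y\mapsto s(x,y)$ is real analytic on $(-r,r)$ for every $x\in[0,1)$. Then: 1. the limit $t(x,y)$ exists for all $x\in[0,1)$ and $|y|<1$, and $y\mapsto t(x,y)$ is real analytic on $(-1,1)$ for every $x\in[0,1)$; 2. at every $x\in[0,1)$ at which $u\mapsto s(u,y)$ is continuous from the right for all $|y|<r$, the function $u\mapsto t(u,y)$ is continuous from the right for all $|y|<1$ (in particular, if $s$ is right-continuous in $x$ on all of $[0,1)$, then so is $t$); 3.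 for every $x\in[0,1)$ and $|y|<1$ the right limit $t(x^+,y)=\lim_{u\downarrow x}t(u,y)$ exists, and the function $t(x^+,y)$ is right-continuous in $x$ on $[0,1)$ and real analytic in $y$ on $(-1,1)$. -/

import Mathlib

open Filter Topology Set

/-- The rotation number `α = (√5 - 1) / 2`. -/
noncomputable def goldenAlpha : ℝ := (Real.sqrt 5 - 1) / 2

/-- The `1`-periodic function `g(x) = cot(πx)`, with its single pole at the integers. -/
noncomputable def cotPi (x : ℝ) : ℝ := Real.cot (Real.pi * x)

/-- The Birkhoff sum `∑_{k=1}^{N} g(θ + k ω)` with rotation number `ω` and starting point `θ`. -/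
noncomputable def cotBirkhoffSum (N : ℕ) (ω θ : ℝ) : ℝ :=
  ∑ k ∈ Finset.Icc 1 N, cotPi (θ + k * ω)

/-- The denominators `q_n` (the Fibonacci numbers) of the convergents of `α`. -/
def fibQ (n : ℕ) : ℕ := Nat.fib n

/-- The numerators `p_n` of the convergents of `α`, so that `q_n = p_{n+1}`
(the value at `n = 0` plays no role). -/
def fibP (n : ℕ) : ℕ := Nat.fib (n - 1)

/-- The rescaled Birkhoff sum `(1/q_n) ∑_{k ≤ [q_n x]} g(y/q_n + k α)`. -/
noncomputable def sApprox (n : ℕ) (x y : ℝ) : ℝ :=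
  cotBirkhoffSum ⌊(fibQ n : ℝ) * x⌋₊ goldenAlpha (y / fibQ n) / fibQ n

/-- The rescaled Birkhoff sum `(1/q_n) ∑_{k ≤ [q_n x]} g(y/q_n + k p_n/q_n)`. -/
noncomputable def tApprox (n : ℕ) (x y : ℝ) : ℝ :=
  cotBirkhoffSum ⌊(fibQ n : ℝ) * x⌋₊ ((fibP n : ℝ) / fibQ n) (y / fibQ n) / fibQ n

/-- `s` is the `s`-function on `[0,1) × (-r,r)`: the limit along the even subsequence exists
there and equals `s`. -/
def IsSFunction (r : ℝ) (s : ℝ → ℝ → ℝ) : Prop :=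
  ∀ x ∈ Ico (0 : ℝ) 1, ∀ y ∈ Ioo (-r) r,
    Tendsto (fun n : ℕ => sApprox (2 * n) x y) atTop (𝓝 (s x y))

/-- `t` is the `t`-function on `[0,1) × (-r,r)`: the limit along the even subsequence exists
there and equals `t`. -/
def IsTFunction (r : ℝ) (t : ℝ → ℝ → ℝ) : Prop :=
  ∀ x ∈ Ico (0 : ℝ) 1, ∀ y ∈ Ioo (-r) r,
    Tendsto (fun n : ℕ => tApprox (2 * n) x y) atTop (𝓝 (t x y))

/-- For every fixed `x ∈ [0,1)` the function `y ↦ f x y` is real analytic on `(-r,r)`. -/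
def IsAnalyticInY (r : ℝ) (f : ℝ → ℝ → ℝ) : Prop :=
  ∀ x ∈ Ico (0 : ℝ) 1, AnalyticOnNhd ℝ (f x) (Ioo (-r) r)

/-- `u ↦ f u y` is continuous from the right at `u = x`, for every `y ∈ (-r,r)`. -/
def IsRightContinuousAt (r : ℝ) (f : ℝ → ℝ → ℝ) (x : ℝ) : Prop :=
  ∀ y ∈ Ioo (-r) r, ContinuousWithinAt (fun u => f u y) (Ici x) x

/-! ### Fibonacci convergents of the golden rotation number -/

/-! Write q = q_{2n}, p = p_{2n}. Since p² ≡ 1 mod q, the substitution l ≡ kp mod q is an involution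
on residues. It turns the condition k ≤ qx into {lp/q} ≤ x, and the sum for t into a sum of (1/q)
cot(π(l+y)/q) over symmetric residues l ≠ 0 (`tApprox_eq_sum`). For s the node l+y is shifted
further by -δ{lp/q}, where δ = q²(p/q - α) → 1/√5 (`sApprox_eq_sum`).

As q → ∞ the kernel tends to 1/(π(l+y)), so the limit should be ∑ c_l/(π(l+y)), with c the limiting
indicator `limInd x`. This series is split. The part ∑ c_l (1/(π(l+y)) - 1/(πl)) is dominated by a
multiple of 1/l² and is analytic for |y| < 1. The part ∑ c_l/(πl) does not involve y; it converges
by summation by parts, because the visits of the orbit to [0,x] on the two sides of 0 balance up to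
O(√N) (`abs_visits_sub_le`). All bounds are uniform in n and x, so dominated convergence gives both
the limits in n (`tendsto_sum_scaledCot_perturbed`) and the right limits in x, where c becomes
`limIndRight x`.

`limInd x` and `limIndRight x` differ only if x = {mα} with m > 0, and then only at l = m. At such a
point the jump of s(·,y) - s(·,0) would be nonzero for small y ≠ 0. Right continuity of s therefore
excludes these x, and elsewhere t equals its right limit. -/

lemma goldenAlpha_eq_neg_goldenConj : goldenAlpha = -Real.goldenConj := by
  unfold goldenAlpha Real.goldenConj
  ring

lemma irrational_goldenAlpha : Irrational goldenAlpha := by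
  rw [goldenAlpha_eq_neg_goldenConj]
  exact Real.goldenConj_irrational.neg

lemma fibQ_pos {n : ℕ} (hn : 0 < n) : 0 < fibQ n := Nat.fib_pos.2 hn

/-- The `n`-th convergent `p_n / q_n` of `α`. -/
noncomputable def fibConv (n : ℕ) : ℝ := (fibP n : ℝ) / fibQ n

lemma fibConv_sub_goldenAlpha {n : ℕ} (hn : 0 < n) :
    fibConv n - goldenAlpha = Real.goldenConj ^ n / fibQ n := by
  have hq : (fibQ n : ℝ) ≠ 0 := by exact_mod_cast (fibQ_pos hn).ne'
  obtain ⟨k, rfl⟩ := Nat.exists_eq_succ_of_ne_zero hn.ne'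
  have h1 := Real.fib_succ_sub_goldenRatio_mul_fib (k + 1)
  have h2 := Real.one_sub_goldenConj
  rw [Nat.fib_add_two] at h1
  push_cast at h1
  rw [goldenAlpha_eq_neg_goldenConj, fibConv, eq_div_iff hq, Nat.succ_eq_add_one, ← h1,
    ← h2]
  rw [Nat.succ_eq_add_one] at hq
  unfold fibP fibQ at *
  simp only [Nat.add_sub_cancel]
  field_simp
  ring

/-- The scaled distance `q_n² (p_n / q_n - α)`. -/
noncomputable def convDefect (n : ℕ) : ℝ := fibQ n * Real.goldenConj ^ n

lemma goldenAlpha_eq_fibConv_sub {n : ℕ} (hn : 0 < n) :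
    goldenAlpha = fibConv n - convDefect n / (fibQ n : ℝ) ^ 2 := by
  have hq : (fibQ n : ℝ) ≠ 0 := by exact_mod_cast (fibQ_pos hn).ne'
  have h := fibConv_sub_goldenAlpha hn
  unfold convDefect
  rw [show goldenAlpha = fibConv n - (fibConv n - goldenAlpha) by ring, h]
  field_simp

lemma abs_goldenConj_lt_one : |Real.goldenConj| < 1 :=
  abs_lt.2 ⟨Real.neg_one_lt_goldenConj, Real.goldenConj_neg.trans one_pos⟩

/-- Binet's formula together with φψ = -1. -/
lemma convDefect_eq (n : ℕ) :
    convDefect n = ((-1) ^ n - Real.goldenConj ^ (2 * n)) / Real.sqrt 5 := by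
  unfold convDefect fibQ
  rw [Real.coe_fib_eq, ← Real.goldenRatio_mul_goldenConj, mul_pow]
  ring

lemma two_lt_sqrt_five : 2 < Real.sqrt 5 :=
  Real.lt_sqrt_of_sq_lt (by norm_num)

lemma goldenConj_pow_two_mul_mem (n : ℕ) :
    0 ≤ Real.goldenConj ^ (2 * n) ∧ Real.goldenConj ^ (2 * n) ≤ 1 := by
  refine ⟨by rw [pow_mul]; positivity, ?_⟩
  rw [← (even_two_mul n).pow_abs]
  exact pow_le_one₀ (abs_nonneg _) abs_goldenConj_lt_one.le

lemma abs_convDefect_le_one (n : ℕ) : |convDefect n| ≤ 1 := by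
  have h := goldenConj_pow_two_mul_mem n
  have h5 := two_lt_sqrt_five
  rw [convDefect_eq, abs_div, abs_of_pos (by linarith : (0 : ℝ) < Real.sqrt 5),
    div_le_one (by linarith)]
  rcases neg_one_pow_eq_or ℝ n with h1 | h1 <;> rw [h1] <;>
    exact abs_le.2 ⟨by linarith, by linarith⟩

/-- The bound 1/2 keeps the nodes of s within |y| + 1/2 of the integers, hence off the poles when
|y| < 1/2. -/
lemma convDefect_even_mem (n : ℕ) :
    0 ≤ convDefect (2 * n) ∧ convDefect (2 * n) ≤ 1 / 2 := by
  have h := goldenConj_pow_two_mul_mem (2 * n)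
  have h5 := two_lt_sqrt_five
  rw [convDefect_eq, (even_two_mul n).neg_one_pow]
  refine ⟨div_nonneg (by linarith) (by linarith), ?_⟩
  rw [div_le_div_iff₀ (by linarith) (by norm_num)]
  linarith

lemma tendsto_convDefect_even :
    Tendsto (fun n : ℕ => convDefect (2 * n)) atTop (𝓝 (1 / Real.sqrt 5)) := by
  have h1 : Tendsto (fun n : ℕ => Real.goldenConj ^ n) atTop (𝓝 0) :=
    tendsto_pow_atTop_nhds_zero_of_abs_lt_one abs_goldenConj_lt_one
  have h2 : Tendsto (fun n : ℕ => 2 * (2 * n)) atTop atTop :=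
    tendsto_atTop_mono (fun n => by simp only [id]; omega) tendsto_id
  have h3 := ((h1.comp h2).const_sub 1).div_const (Real.sqrt 5)
  rw [sub_zero] at h3
  refine h3.congr fun n => ?_
  rw [convDefect_eq, (even_two_mul n).neg_one_pow]
  rfl

lemma abs_fibConv_sub_le {m n : ℕ} (hm : 0 < m) (hmn : m ≤ n) :
    |fibConv n - fibConv m| ≤ 2 / (fibQ m : ℝ) ^ 2 := by
  have hq : (0 : ℝ) < fibQ m := by exact_mod_cast fibQ_pos hm
  have key : ∀ k, m ≤ k → |fibConv k - goldenAlpha| ≤ 1 / (fibQ m : ℝ) ^ 2 := by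
    intro k hk
    have hle : (fibQ m : ℝ) ≤ fibQ k := by exact_mod_cast Nat.fib_mono hk
    have hqk : (0 : ℝ) < fibQ k := hq.trans_le hle
    have h1 : |fibConv k - goldenAlpha| = |convDefect k| / (fibQ k : ℝ) ^ 2 := by
      rw [fibConv_sub_goldenAlpha (hm.trans_le hk), convDefect, abs_mul, abs_div,
        abs_of_pos hqk]
      field_simp
    rw [h1]
    have := abs_convDefect_le_one k
    gcongr
  have h1 := key n hmn
  have h2 := key m le_rfl
  calc |fibConv n - fibConv m|
      = |(fibConv n - goldenAlpha) - (fibConv m - goldenAlpha)| := by ring_nf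
    _ ≤ |fibConv n - goldenAlpha| + |fibConv m - goldenAlpha| := abs_sub _ _
    _ ≤ 2 / (fibQ m : ℝ) ^ 2 := by
      rw [show (2 : ℝ) / (fibQ m : ℝ) ^ 2 = 1 / (fibQ m : ℝ) ^ 2 + 1 / (fibQ m : ℝ) ^ 2 by ring]
      exact add_le_add h1 h2

lemma isCoprime_fibP_fibQ {n : ℕ} (hn : 0 < n) : IsCoprime (fibP n : ℤ) (fibQ n : ℤ) := by
  obtain ⟨k, rfl⟩ := Nat.exists_eq_succ_of_ne_zero hn.ne'
  exact Nat.isCoprime_iff_coprime.2 (Nat.fib_coprime_fib_succ k)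

/-- For even `n`, the numerator `p_n` is its own inverse modulo `q_n`. -/
lemma fibQ_dvd_fibP_sq_sub_one (n : ℕ) (hn : 0 < n) :
    (fibQ (2 * n) : ℤ) ∣ (fibP (2 * n) : ℤ) * fibP (2 * n) - 1 := by
  -- Cassini's identity at the odd index 2n - 1, whose sign makes the square +1 modulo q.
  have h := Int.fib_succ_mul_fib_pred_sub_fib_sq (2 * n - 1 : ℤ)
  have e1 : (2 * n - 1 : ℤ) + 1 = ((2 * n : ℕ) : ℤ) := by push_cast; ring
  have e2 : (2 * n - 1 : ℤ) = ((2 * n - 1 : ℕ) : ℤ) := by omega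
  have e3 : (2 * n - 1 : ℤ) - 1 = ((2 * n - 2 : ℕ) : ℤ) := by omega
  rw [e1, e3, e2, Int.fib_natCast, Int.fib_natCast, Int.fib_natCast, Int.natAbs_natCast,
    (show Odd (2 * n - 1) from ⟨n - 1, by omega⟩).neg_one_pow] at h
  refine ⟨Nat.fib (2 * n - 2), ?_⟩
  unfold fibP fibQ
  linarith

/-! ### Discrepancy of the rotations by the convergents -/

/-- The number of points of an orbit block of Fibonacci length visiting a given interval. -/
lemma card_block_le {m n : ℕ} (hm : 0 < m) (hmn : m ≤ n) (b : ℤ) {u v : ℝ} (huv : u ≤ v) :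
    (((Finset.range (fibQ m)).filter fun i : ℕ =>
      u ≤ Int.fract (((b + i : ℤ) : ℝ) * fibConv n) ∧
        Int.fract (((b + i : ℤ) : ℝ) * fibConv n) ≤ v).card : ℝ) ≤ fibQ m * (v - u) + 5 := by
  set Q := fibQ m with hQ
  have hQ0 : 0 < Q := fibQ_pos hm
  have hQr : (0 : ℝ) < Q := by exact_mod_cast hQ0
  -- `U i` is congruent to i p_m mod Q, so these integers are distinct for i < Q. It also lies
  -- within 2 of Q times the orbit point, translated by a constant. Counting points thus reduces to
  -- counting integers in an interval of length Q(v - u) + 4.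
  set U : ℕ → ℤ := fun i => i * fibP m - Q * ⌊((b + i : ℤ) : ℝ) * fibConv n⌋ with hU
  set lo : ℝ := Q * (u - b * fibConv n) - 2 with hlo
  set hi : ℝ := Q * (v - b * fibConv n) + 2 with hhi
  have hdist := abs_fibConv_sub_le hm hmn
  have hmaps : ∀ i ∈ (Finset.range Q).filter (fun i : ℕ =>
      u ≤ Int.fract (((b + i : ℤ) : ℝ) * fibConv n) ∧
        Int.fract (((b + i : ℤ) : ℝ) * fibConv n) ≤ v), U i ∈ Finset.Icc ⌈lo⌉ ⌊hi⌋ := by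
    intro i hi'
    rw [Finset.mem_filter, Finset.mem_range] at hi'
    obtain ⟨hiQ, h1, h2⟩ := hi'
    have hiQ' : (i : ℝ) ≤ Q := by exact_mod_cast hiQ.le
    have hUe : (U i : ℝ) = Q * (Int.fract (((b + i : ℤ) : ℝ) * fibConv n) - b * fibConv n)
        - Q * (i * (fibConv n - fibConv m)) := by
      have : (Q : ℝ) * fibConv m = fibP m := by
        rw [fibConv, ← hQ]; field_simp
      simp only [hU, Int.fract]
      push_cast
      rw [← this]
      ring
    have herr : |(Q : ℝ) * (i * (fibConv n - fibConv m))| ≤ 2 := by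
      rw [abs_mul, abs_mul, abs_of_pos hQr, abs_of_nonneg (Nat.cast_nonneg i)]
      calc (Q : ℝ) * (i * |fibConv n - fibConv m|) ≤ Q * (Q * (2 / (Q : ℝ) ^ 2)) := by gcongr
        _ = 2 := by field_simp
    obtain ⟨h3, h4⟩ := abs_le.1 herr
    have h5 := mul_le_mul_of_nonneg_left h1 hQr.le
    have h6 := mul_le_mul_of_nonneg_left h2 hQr.le
    rw [Finset.mem_Icc, Int.ceil_le, Int.le_floor, hUe, hlo, hhi]
    constructor <;> linarith
  have hinj : Set.InjOn U ((Finset.range Q).filter (fun i : ℕ =>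
      u ≤ Int.fract (((b + i : ℤ) : ℝ) * fibConv n) ∧
        Int.fract (((b + i : ℤ) : ℝ) * fibConv n) ≤ v)) := by
    intro i hi' j hj' hij
    have hi1 := Finset.mem_range.1 (Finset.mem_filter.1 (Finset.mem_coe.1 hi')).1
    have hj1 := Finset.mem_range.1 (Finset.mem_filter.1 (Finset.mem_coe.1 hj')).1
    have hdvd : (Q : ℤ) ∣ ((i : ℤ) - j) * fibP m := by
      refine ⟨⌊((b + i : ℤ) : ℝ) * fibConv n⌋ - ⌊((b + j : ℤ) : ℝ) * fibConv n⌋, ?_⟩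
      simp only [hU] at hij
      linarith
    have h2 := (isCoprime_fibP_fibQ hm).symm.dvd_of_dvd_mul_right hdvd
    have h3 := Int.eq_zero_of_abs_lt_dvd h2 (by rw [abs_lt]; omega)
    omega
  have hcard := Finset.card_le_card_of_injOn U hmaps hinj
  rw [Int.card_Icc] at hcard
  have hlohi : lo + 4 ≤ hi := by
    have := mul_le_mul_of_nonneg_left huv hQr.le
    rw [hlo, hhi]; linarith
  have hpos : 0 ≤ ⌊hi⌋ + 1 - ⌈lo⌉ := by
    have h1 := Int.lt_floor_add_one hi
    have h2 := Int.ceil_lt_add_one lo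
    have : (⌈lo⌉ : ℝ) ≤ ((⌊hi⌋ + 1 : ℤ) : ℝ) := by push_cast; linarith
    have := Int.cast_le.1 this
    linarith
  have h7 : ((⌊hi⌋ + 1 - ⌈lo⌉).toNat : ℝ) = ((⌊hi⌋ + 1 - ⌈lo⌉ : ℤ) : ℝ) := by
    have := Int.toNat_of_nonneg hpos
    exact_mod_cast congrArg (Int.cast : ℤ → ℝ) this
  have h8 := Int.floor_le hi
  have h9 := Int.le_ceil lo
  calc _ ≤ ((⌊hi⌋ + 1 - ⌈lo⌉).toNat : ℝ) := by exact_mod_cast hcard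
    _ = (⌊hi⌋ : ℝ) + 1 - ⌈lo⌉ := by rw [h7]; push_cast; ring
    _ ≤ hi + 1 - lo := by linarith
    _ = Q * (v - u) + 5 := by rw [hlo, hhi]; ring

/-- The number of visits to `[0, x]` of the orbit piece `b, …, b + N - 1` of the rotation by
the `n`-th convergent. -/
noncomputable def visits (n : ℕ) (x : ℝ) (b : ℤ) (N : ℕ) : ℝ :=
  ∑ i ∈ Finset.range N, if Int.fract (((b + i : ℤ) : ℝ) * fibConv n) ≤ x then (1 : ℝ) else 0

lemma visits_add (n : ℕ) (x : ℝ) (b : ℤ) (M N : ℕ) :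
    visits n x b (M + N) = visits n x b M + visits n x (b + M) N := by
  unfold visits
  rw [Finset.sum_range_add]
  simp only [Nat.cast_add, add_assoc]

/-- The lower bound is the upper bound of `card_block_le` applied to the complementary interval [x,
1]. -/
lemma abs_visits_block_le {m n : ℕ} (hm : 0 < m) (hmn : m ≤ n) (b : ℤ) {x : ℝ}
    (hx : x ∈ Ico (0 : ℝ) 1) : |visits n x b (fibQ m) - fibQ m * x| ≤ 5 := by
  have h1 := card_block_le hm hmn b hx.1
  have h2 := card_block_le hm hmn b hx.2.le
  have e1 : visits n x b (fibQ m) = (((Finset.range (fibQ m)).filter fun i : ℕ =>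
      Int.fract (((b + i : ℤ) : ℝ) * fibConv n) ≤ x).card : ℝ) := by
    rw [visits, Finset.sum_boole]
  have e2 := Finset.card_filter_add_card_filter_not (s := Finset.range (fibQ m))
    (fun i : ℕ => Int.fract (((b + i : ℤ) : ℝ) * fibConv n) ≤ x)
  rw [Finset.card_range] at e2
  have e3 : ((Finset.range (fibQ m)).filter fun i : ℕ =>
      ¬ Int.fract (((b + i : ℤ) : ℝ) * fibConv n) ≤ x) ⊆
      (Finset.range (fibQ m)).filter fun i : ℕ =>
        x ≤ Int.fract (((b + i : ℤ) : ℝ) * fibConv n) ∧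
        Int.fract (((b + i : ℤ) : ℝ) * fibConv n) ≤ 1 := by
    intro i hi
    rw [Finset.mem_filter] at hi ⊢
    exact ⟨hi.1, (not_le.1 hi.2).le, (Int.fract_lt_one _).le⟩
  have e4 : (_ : ℝ) ≤ _ := Nat.cast_le.2 (Finset.card_le_card e3)
  have e5 := congrArg (Nat.cast : ℕ → ℝ) e2
  rw [Nat.cast_add] at e5
  simp only [Int.fract_nonneg, true_and] at h1
  rw [e1, abs_le]
  constructor <;> linarith

/-- The discrepancy of an orbit piece of length `N < q_n` is `O(√N)`. -/
lemma abs_visits_sub_le {n : ℕ} {x : ℝ} (hx : x ∈ Ico (0 : ℝ) 1) (N : ℕ) (hN : N < fibQ n) :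
    ∀ b : ℤ, |visits n x b N - N * x| ≤ 20 * Real.sqrt N := by
  induction N using Nat.strong_induction_on with
  | _ N ih =>
    intro b
    rcases Nat.eq_zero_or_pos N with rfl | hpos
    · simp [visits]
    -- Greedy Zeckendorf step: splitting off the largest Fibonacci block leaves at most N/2 points.
    set m := N.greatestFib with hm
    have hle : fibQ m ≤ N := Nat.fib_greatestFib_le N
    have hlt : N < Nat.fib (m + 1) := Nat.lt_fib_greatestFib_add_one N
    have hm0 : 0 < m := Nat.greatestFib_pos.2 hpos
    have hmn : m ≤ n := by
      by_contra h
      have : fibQ n ≤ fibQ m := Nat.fib_mono (by omega)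
      omega
    have hhalf : 2 * (N - fibQ m) ≤ N := by
      have h1 : Nat.fib (m + 1) = Nat.fib (m - 1) + Nat.fib m := by
        obtain ⟨k, hk⟩ := Nat.exists_eq_succ_of_ne_zero hm0.ne'
        rw [hk]
        exact Nat.fib_add_two
      have h2 : Nat.fib (m - 1) ≤ Nat.fib m := Nat.fib_mono (by omega)
      unfold fibQ at *
      omega
    have hq0 := fibQ_pos hm0
    obtain ⟨R, hR⟩ := Nat.exists_eq_add_of_le hle
    have h1 := ih R (by omega) (by omega) (b + fibQ m)
    have h2 := abs_visits_block_le hm0 hmn b hx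
    rw [hR, visits_add]
    -- As √(1/2) < 3/4, the induction closes with 5 + 20 · (3/4)√N ≤ 20√N.
    have h3 : Real.sqrt R ≤ 3 / 4 * Real.sqrt (fibQ m + R : ℕ) := by
      have h4 : (2 : ℝ) * R ≤ (fibQ m + R : ℕ) := by
        have : 2 * R ≤ fibQ m + R := by omega
        exact_mod_cast this
      rw [Real.sqrt_le_left (by positivity), mul_pow, Real.sq_sqrt (by positivity)]
      nlinarith
    have h5 : 1 ≤ Real.sqrt (fibQ m + R : ℕ) := by
      rw [Real.one_le_sqrt]
      exact_mod_cast (by omega : 1 ≤ fibQ m + R)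
    have h6 := abs_add_le (visits n x b (fibQ m) - fibQ m * x)
      (visits n x (b + fibQ m) R - R * x)
    have h7 : visits n x b (fibQ m) + visits n x (b + fibQ m) R - ((fibQ m + R : ℕ) : ℝ) * x
      = (visits n x b (fibQ m) - fibQ m * x) + (visits n x (b + fibQ m) R - R * x) := by
      push_cast; ring
    rw [h7]
    linarith

/-! ### The rescaled cotangent -/

/-- The function `g(z / q) / q`. -/
noncomputable def scaledCot (q : ℕ) (z : ℝ) : ℝ := cotPi (z / q) / q

lemma scaledCot_zero (q : ℕ) : scaledCot q 0 = 0 := by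
  simp [scaledCot, cotPi, Real.cot_eq_cos_div_sin]

lemma scaledCot_neg (q : ℕ) (z : ℝ) : scaledCot q (-z) = -scaledCot q z := by
  simp [scaledCot, cotPi, Real.cot_eq_cos_div_sin, neg_div, div_neg]

lemma scaledCot_half {q : ℕ} (hq : 0 < q) : scaledCot q (q / 2) = 0 := by
  have hq' : (q : ℝ) ≠ 0 := by exact_mod_cast hq.ne'
  have : Real.pi * ((q : ℝ) / 2 / q) = Real.pi / 2 := by field_simp
  simp [scaledCot, cotPi, Real.cot_eq_cos_div_sin, this]

lemma cotPi_add_int (z : ℝ) (k : ℤ) : cotPi (z + k) = cotPi z := by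
  rw [cotPi, cotPi, Real.cot_eq_cos_div_sin, Real.cot_eq_cos_div_sin, mul_add,
    mul_comm Real.pi (k : ℝ), Real.cos_add_int_mul_pi, Real.sin_add_int_mul_pi]
  rcases Int.even_or_odd k with h | h <;> simp [h.neg_one_zpow, neg_div_neg_eq]

lemma scaledCot_add_int_mul {q : ℕ} (hq : 0 < q) (z : ℝ) (k : ℤ) :
    scaledCot q (z + q * k) = scaledCot q z := by
  have hq' : (q : ℝ) ≠ 0 := by exact_mod_cast hq.ne'
  rw [scaledCot, scaledCot, add_div, mul_div_cancel_left₀ _ hq', cotPi_add_int]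

lemma scaledCot_sub {q : ℕ} {u v : ℝ} (hu : Real.sin (Real.pi * (u / q)) ≠ 0)
    (hv : Real.sin (Real.pi * (v / q)) ≠ 0) :
    scaledCot q u - scaledCot q v = Real.sin (Real.pi * ((v - u) / q)) /
      (q * (Real.sin (Real.pi * (u / q)) * Real.sin (Real.pi * (v / q)))) := by
  have h : Real.pi * ((v - u) / q) = Real.pi * (v / q) - Real.pi * (u / q) := by ring
  rw [h, Real.sin_sub, scaledCot, scaledCot, cotPi, cotPi, Real.cot_eq_cos_div_sin,
    Real.cot_eq_cos_div_sin, ← sub_div, div_sub_div _ _ hu hv, div_div]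
  congr 1 <;> ring

lemma abs_sin_scaled_le (q : ℕ) (z : ℝ) :
    |Real.sin (Real.pi * (z / q))| ≤ Real.pi * (|z| / q) := by
  refine Real.abs_sin_le_abs.trans (le_of_eq ?_)
  rw [abs_mul, abs_div, abs_of_pos Real.pi_pos, Nat.abs_cast]

lemma le_abs_sin_scaled {q : ℕ} (hq : 0 < q) {z : ℝ} (hz : |z| ≤ q / 2) :
    2 * (|z| / q) ≤ |Real.sin (Real.pi * (z / q))| := by
  have hq' : (0 : ℝ) < q := by exact_mod_cast hq
  have e : |Real.pi * (z / q)| = Real.pi * (|z| / q) := by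
    rw [abs_mul, abs_div, abs_of_pos Real.pi_pos, Nat.abs_cast]
  have h1 : |Real.pi * (z / q)| ≤ Real.pi / 2 := by
    rw [e]
    have : |z| / q ≤ 1 / 2 := by rw [div_le_iff₀ hq']; linarith
    nlinarith [Real.pi_pos]
  have h2 := Real.mul_abs_le_abs_sin h1
  rw [e] at h2
  refine le_trans (le_of_eq ?_) h2
  field_simp [Real.pi_pos.ne']

/-- Lower bound for the sine at a perturbed integer. -/
lemma le_abs_sin_scaled_perturbed {q : ℕ} (hq : 4 ≤ q) {l : ℤ} (hl : 2 * |l| ≤ q) (hl0 : l ≠ 0)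
    {ρ z : ℝ} (hρ : ρ < 1) (hz : |z| ≤ ρ) :
    (1 - ρ) * (|(l : ℝ)| / q) ≤ |Real.sin (Real.pi * ((l + z) / q))| := by
  have hq4 : (4 : ℝ) ≤ q := by exact_mod_cast hq
  have hq' : (0 : ℝ) < q := by linarith
  have hρ0 : 0 ≤ ρ := (abs_nonneg z).trans hz
  have hl1 : (1 : ℝ) ≤ |(l : ℝ)| := by exact_mod_cast Int.one_le_abs hl0
  have hlq : 2 * |(l : ℝ)| ≤ q := by exact_mod_cast hl
  have h1 : |(l : ℝ)| - |z| ≤ |(l : ℝ) + z| := by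
    have := abs_sub_abs_le_abs_sub (l : ℝ) (-z)
    rwa [abs_neg, sub_neg_eq_add] at this
  rcases le_total |(l : ℝ) + z| (q / 2) with h | h
  · refine le_trans ?_ (le_abs_sin_scaled (by omega) h)
    rw [← mul_div_assoc, ← mul_div_assoc]
    refine div_le_div_of_nonneg_right ?_ hq'.le
    nlinarith
  -- The perturbed node may overshoot q/2 by at most ρ. It is reflected at q/2, and q ≥ 4 absorbs
  -- the loss 2ρ.
  · have h2 : |(l : ℝ) + z| ≤ |(l : ℝ)| + |z| := abs_add_le _ _
    have h3 : |Real.sin (Real.pi * ((l + z) / q))|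
        = |Real.sin (Real.pi * ((q - |(l : ℝ) + z|) / q))| := by
      have e : Real.pi * ((q - |(l : ℝ) + z|) / q) = Real.pi - Real.pi * (|(l : ℝ) + z| / q) := by
        field_simp
      rw [e, Real.sin_pi_sub]
      rcases abs_choice ((l : ℝ) + z) with h4 | h4 <;> rw [h4]
      rw [neg_div, mul_neg, Real.sin_neg, abs_neg]
    have h5 : abs ((q : ℝ) - |(l : ℝ) + z|) = q - |(l : ℝ) + z| := abs_of_nonneg (by linarith)
    rw [h3]
    refine le_trans ?_ (le_abs_sin_scaled (by omega) (by rw [h5]; linarith))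
    rw [h5, ← mul_div_assoc, ← mul_div_assoc]
    refine div_le_div_of_nonneg_right ?_ hq'.le
    nlinarith

/-- The bound does not depend on q, so it serves as the summable majorant in dominated convergence.
-/
lemma abs_scaledCot_sub_le {q : ℕ} (hq : 4 ≤ q) {l : ℤ} (hl : 2 * |l| ≤ q) (hl0 : l ≠ 0)
    {ρ z : ℝ} (hρ : ρ < 1) (hz : |z| ≤ ρ) :
    |scaledCot q (l + z) - scaledCot q l| ≤ Real.pi / (2 * (1 - ρ)) * (1 / (l : ℝ) ^ 2) := by
  have hq' : (0 : ℝ) < q := by exact_mod_cast (by omega : 0 < q)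
  have hρ0 : 0 ≤ ρ := (abs_nonneg z).trans hz
  have hl1 : (0 : ℝ) < |(l : ℝ)| := abs_pos.2 (by exact_mod_cast hl0)
  have hlq : |(l : ℝ)| ≤ q / 2 := by
    have : 2 * |(l : ℝ)| ≤ q := by exact_mod_cast hl
    linarith
  have h1 := le_abs_sin_scaled_perturbed hq hl hl0 hρ hz
  have h2 := le_abs_sin_scaled (by omega : 0 < q) hlq
  have hp1 : 0 < (1 - ρ) * (|(l : ℝ)| / q) := mul_pos (by linarith) (by positivity)
  have hp2 : 0 < 2 * (|(l : ℝ)| / q) := by positivity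
  have h3 := abs_sin_scaled_le q ((l : ℝ) - (l + z))
  have hz1 : |(l : ℝ) - (l + z)| ≤ 1 := by
    rw [sub_add_cancel_left, abs_neg]; linarith
  rw [scaledCot_sub (abs_pos.1 (hp1.trans_le h1)) (abs_pos.1 (hp2.trans_le h2)), abs_div,
    abs_mul, abs_mul, Nat.abs_cast]
  calc _ ≤ (Real.pi * (1 / q)) / (q * (((1 - ρ) * (|(l : ℝ)| / q)) * (2 * (|(l : ℝ)| / q)))) := by
        gcongr
        exact h3.trans (by gcongr)
    _ = Real.pi / (2 * (1 - ρ)) * (1 / |(l : ℝ)| ^ 2) := by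
        have : 1 - ρ ≠ 0 := by linarith
        field_simp
    _ = _ := by rw [sq_abs]

/-- The rescaled cotangent clamped at its zero `q / 2`. -/
noncomputable def clampedCot (q : ℕ) (l : ℕ) : ℝ := scaledCot q (min (l : ℝ) (q / 2))

lemma abs_clampedCot_sub_le {q : ℕ} (hq : 2 ≤ q) (i : ℕ) :
    |clampedCot q (i + 1) - clampedCot q (i + 2)| ≤
      Real.pi / 4 * (1 / ((i + 1 : ℕ) : ℝ) ^ 2) := by
  have hq2 : (2 : ℝ) ≤ q := by exact_mod_cast hq
  have hq' : (0 : ℝ) < q := by linarith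
  unfold clampedCot
  rcases le_total ((q : ℝ) / 2) ((i + 1 : ℕ) : ℝ) with h | h
  · have h' : (q : ℝ) / 2 ≤ ((i + 2 : ℕ) : ℝ) := by
      refine h.trans ?_
      exact_mod_cast (by omega : i + 1 ≤ i + 2)
    rw [min_eq_right h, min_eq_right h', sub_self, abs_zero]
    have := Real.pi_pos
    positivity
  · rw [min_eq_left h]
    set a : ℝ := ((i + 1 : ℕ) : ℝ) with ha
    set b : ℝ := min ((i + 2 : ℕ) : ℝ) (q / 2) with hb
    have ha0 : 0 < a := by rw [ha]; positivity
    have hia : ((i + 2 : ℕ) : ℝ) = a + 1 := by rw [ha]; push_cast; ring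
    have hab : a ≤ b := le_min (by linarith) h
    have hb1 : b ≤ a + 1 := hia ▸ min_le_left _ _
    have hbq : b ≤ q / 2 := min_le_right _ _
    have h1 := le_abs_sin_scaled (by omega : 0 < q) (z := a) (by rwa [abs_of_pos ha0])
    have h2 := le_abs_sin_scaled (by omega : 0 < q) (z := b)
      (by rwa [abs_of_pos (ha0.trans_le hab)])
    rw [abs_of_pos ha0] at h1
    rw [abs_of_pos (ha0.trans_le hab)] at h2
    have h2' : 2 * (a / q) ≤ |Real.sin (Real.pi * (b / q))| := le_trans (by gcongr) h2
    have hp : 0 < 2 * (a / q) := by positivity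
    have h3 := abs_sin_scaled_le q (b - a)
    have hba : |b - a| ≤ 1 := abs_le.2 ⟨by linarith, by linarith⟩
    rw [scaledCot_sub (abs_pos.1 (hp.trans_le h1)) (abs_pos.1 (hp.trans_le h2')), abs_div,
      abs_mul, abs_mul, Nat.abs_cast]
    have hpi := Real.pi_pos
    calc _ ≤ (Real.pi * (1 / q)) / (q * ((2 * (a / q)) * (2 * (a / q)))) := by
          gcongr
          exact h3.trans (by gcongr)
      _ = _ := by field_simp; ring

lemma tendsto_scaledCot {Q : ℕ → ℕ} (hQ : Tendsto Q atTop atTop) {w : ℕ → ℝ} {v : ℝ}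
    (hw : Tendsto w atTop (𝓝 v)) (hv : v ≠ 0) :
    Tendsto (fun n => scaledCot (Q n) (w n)) atTop (𝓝 (1 / (Real.pi * v))) := by
  have hQr : Tendsto (fun n => (Q n : ℝ)) atTop atTop := tendsto_natCast_atTop_atTop.comp hQ
  have h0 : Tendsto (fun n => Real.pi * (w n / Q n)) atTop (𝓝 0) := by
    have := (hw.div_atTop hQr).const_mul Real.pi
    rwa [mul_zero] at this
  have hs : Tendsto (fun n => Real.sinc (Real.pi * (w n / Q n))) atTop (𝓝 1) := by
    have := (Real.continuous_sinc.tendsto 0).comp h0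
    rwa [Real.sinc_zero] at this
  have hc : Tendsto (fun n => Real.cos (Real.pi * (w n / Q n))) atTop (𝓝 1) := by
    have := (Real.continuous_cos.tendsto 0).comp h0
    rwa [Real.cos_zero] at this
  have hd : Tendsto (fun n => Real.pi * w n * Real.sinc (Real.pi * (w n / Q n))) atTop
      (𝓝 (Real.pi * v)) := by
    have := (hw.const_mul Real.pi).mul hs
    rwa [mul_one] at this
  refine (hc.div hd (mul_ne_zero Real.pi_pos.ne' hv)).congr' ?_
  filter_upwards [hQ.eventually_ge_atTop 1, hw.eventually_ne hv] with n hn hwn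
  have hq : (Q n : ℝ) ≠ 0 := by exact_mod_cast (by omega : Q n ≠ 0)
  have hne : Real.pi * (w n / Q n) ≠ 0 := mul_ne_zero Real.pi_pos.ne' (div_ne_zero hwn hq)
  have hpi := Real.pi_pos.ne'
  simp only [Pi.div_apply]
  rw [scaledCot, cotPi, Real.cot_eq_cos_div_sin, Real.sinc_of_ne_zero hne, div_div]
  congr 1
  field_simp

/-! ### Birkhoff sums as sums over residues -/

/-- The indicator of the nonzero integers `l` with `{l p_n / q_n} ≤ x`. -/
noncomputable def convInd (n : ℕ) (x : ℝ) (l : ℤ) : ℝ :=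
  if l ≠ 0 ∧ Int.fract (l * fibConv n) ≤ x then 1 else 0

/-- The symmetric residues modulo `q`. -/
noncomputable def symmResidues (q : ℕ) : Finset ℤ := Finset.Ico (-((q : ℤ) / 2)) (((q : ℤ) + 1) / 2)

lemma two_mul_abs_le_of_mem_symmResidues {q : ℕ} {l : ℤ} (h : l ∈ symmResidues q) :
    2 * |l| ≤ q := by
  rw [symmResidues, Finset.mem_Ico] at h
  rcases abs_choice l with h1 | h1 <;> rw [h1] <;> omega

lemma fract_int_mul_fibConv (n : ℕ) (l : ℤ) :
    Int.fract (l * fibConv n) = ((l * fibP n % fibQ n : ℤ) : ℝ) / fibQ n := by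
  rw [← Int.fract_div_intCast_eq_div_intCast_mod, fibConv]
  push_cast
  rw [mul_div_assoc]

lemma modEq_mul_fibP_mul_fibP {n : ℕ} (hn : 0 < n) (l : ℤ) :
    l * fibP (2 * n) * fibP (2 * n) ≡ l [ZMOD fibQ (2 * n)] := by
  refine (Int.modEq_iff_dvd.2 ?_).symm
  obtain ⟨c, hc⟩ := fibQ_dvd_fibP_sq_sub_one n hn
  exact ⟨l * c, by linear_combination l * hc⟩

/-- Reindexing by k ↦ kp reduced to a symmetric residue; the inverse is l ↦ lp mod q because p² ≡ 1.
The condition x < 1 keeps k below q. General `G` and `H` let one bijection serve both s and t. -/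
lemma sum_Icc_eq_sum_symmResidues {n : ℕ} (hn : 0 < n) {x : ℝ} (hx : x ∈ Ico (0 : ℝ) 1)
    (G : ℕ → ℝ) (H : ℤ → ℝ)
    (hGH : ∀ (k : ℕ) (l : ℤ), 0 < k → k < fibQ (2 * n) →
      (k : ℤ) * fibP (2 * n) ≡ l [ZMOD fibQ (2 * n)] →
      Int.fract (l * fibConv (2 * n)) = (k : ℝ) / fibQ (2 * n) → G k = H l) :
    ∑ k ∈ Finset.Icc 1 ⌊(fibQ (2 * n) : ℝ) * x⌋₊, G k =
      ∑ l ∈ symmResidues (fibQ (2 * n)), convInd (2 * n) x l * H l := by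
  set q := fibQ (2 * n) with hq
  set p := fibP (2 * n) with hp
  have hq0 : 0 < q := fibQ_pos (by omega)
  have hqr : (0 : ℝ) < q := by exact_mod_cast hq0
  have hqz : (0 : ℤ) < q := by exact_mod_cast hq0
  have hcop : IsCoprime (p : ℤ) (q : ℤ) := isCoprime_fibP_fibQ (by omega)
  have hfl : ⌊(q : ℝ) * x⌋₊ < q := by
    rw [Nat.floor_lt (mul_nonneg hqr.le hx.1)]
    exact mul_lt_of_lt_one_right hqr hx.2
  have hmod (l : ℤ) : l * p * p ≡ l [ZMOD q] := modEq_mul_fibP_mul_fibP hn l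
  have hbm (z : ℤ) : z.bmod q ≡ z [ZMOD q] := Int.bmod_emod
  have hemod {k : ℤ} {l : ℤ} (h : k * p ≡ l [ZMOD q]) (h0 : 0 ≤ k) (h1 : k < q) :
      l * p % q = k := by
    have h2 : l * p ≡ k [ZMOD q] := (h.symm.mul_right p).trans (hmod k)
    rw [h2, Int.emod_eq_of_lt h0 h1]
  have hback (l : ℤ) : (l * p % q) * p ≡ l [ZMOD q] :=
    ((Int.mod_modEq (l * p) q).mul_right p).trans (hmod l)
  have hconv : ∑ l ∈ symmResidues q, convInd (2 * n) x l * H l =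
      ∑ l ∈ (symmResidues q).filter
        (fun l : ℤ => l ≠ 0 ∧ Int.fract (l * fibConv (2 * n)) ≤ x), H l := by
    rw [Finset.sum_filter]
    refine Finset.sum_congr rfl fun l _ => ?_
    rw [convInd]
    split_ifs <;> simp
  rw [hconv]
  refine Finset.sum_nbij' (fun k => ((k : ℤ) * p).bmod q) (fun l : ℤ => (l * p % q).toNat)
    ?_ ?_ ?_ ?_ ?_
  · intro k hk
    rw [Finset.mem_Icc] at hk
    have hkq : k < q := by omega
    have hfr := hemod (hbm ((k : ℤ) * p)).symm (by omega) (by omega)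
    rw [Finset.mem_filter, symmResidues, Finset.mem_Ico]
    refine ⟨⟨Int.le_bmod hq0, Int.bmod_lt hq0⟩, ?_, ?_⟩
    · intro h0
      rw [h0, zero_mul, Int.zero_emod] at hfr
      omega
    · rw [fract_int_mul_fibConv, ← hp, ← hq, hfr, div_le_iff₀ hqr, mul_comm]
      push_cast
      exact (Nat.le_floor_iff (mul_nonneg hqr.le hx.1)).1 hk.2
  · intro l hl
    rw [Finset.mem_filter] at hl
    obtain ⟨hlJ, hl0, hlx⟩ := hl
    have hnn := Int.emod_nonneg (l * p) hqz.ne'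
    rw [fract_int_mul_fibConv, ← hp, ← hq, div_le_iff₀ hqr] at hlx
    rw [Finset.mem_Icc]
    constructor
    · by_contra h
      have h1 : l * p % q = 0 := by omega
      have h2 := hcop.symm.dvd_of_dvd_mul_right (Int.dvd_of_emod_eq_zero h1)
      have h3 := two_mul_abs_le_of_mem_symmResidues hlJ
      exact hl0 (Int.eq_zero_of_abs_lt_dvd h2 (by omega))
    · refine Nat.le_floor ?_
      have : ((l * p % q).toNat : ℝ) = ((l * p % q : ℤ) : ℝ) := by
        exact_mod_cast congrArg (Int.cast : ℤ → ℝ) (Int.toNat_of_nonneg hnn)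
      rw [this]
      linarith
  · intro k hk
    rw [Finset.mem_Icc] at hk
    have hfr := hemod (hbm ((k : ℤ) * p)).symm (by omega) (by omega)
    simp only [hfr, Int.toNat_natCast]
  · intro l hl
    rw [Finset.mem_filter] at hl
    have hnn := Int.emod_nonneg (l * p) hqz.ne'
    simp only [Int.toNat_of_nonneg hnn]
    have h1 : (l * p % q * p).bmod q ≡ l [ZMOD q] := (hbm _).trans (hback l)
    have h2 := h1.symm.dvd
    have h3 := Int.le_bmod (x := l * p % q * p) hq0
    have h4 := Int.bmod_lt (x := l * p % q * p) hq0
    have h5 := Finset.mem_Ico.1 hl.1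
    have h6 := Int.eq_zero_of_abs_lt_dvd h2 (by rw [abs_lt]; omega)
    omega
  · intro k hk
    rw [Finset.mem_Icc] at hk
    have hfr := hemod (hbm ((k : ℤ) * p)).symm (by omega) (by omega)
    refine hGH k _ (by omega) (by omega) (hbm _).symm ?_
    rw [fract_int_mul_fibConv, ← hp, ← hq, hfr]
    push_cast
    rfl

lemma tApprox_eq_sum {n : ℕ} (hn : 0 < n) {x : ℝ} (hx : x ∈ Ico (0 : ℝ) 1) (y : ℝ) :
    tApprox (2 * n) x y = ∑ l ∈ symmResidues (fibQ (2 * n)),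
      convInd (2 * n) x l * scaledCot (fibQ (2 * n)) (l + y) := by
  have hq0 : 0 < fibQ (2 * n) := fibQ_pos (by omega)
  have hqr : (fibQ (2 * n) : ℝ) ≠ 0 := by exact_mod_cast hq0.ne'
  rw [tApprox, cotBirkhoffSum, Finset.sum_div]
  refine sum_Icc_eq_sum_symmResidues hn hx _ _ fun k l _ _ hkl _ => ?_
  obtain ⟨c, hc⟩ := hkl.dvd
  have hc' : (l : ℝ) - k * fibP (2 * n) = fibQ (2 * n) * c := by exact_mod_cast hc
  have e : (l : ℝ) + y = (k * fibP (2 * n) + y) + fibQ (2 * n) * c := by linarith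
  rw [e, scaledCot_add_int_mul hq0, scaledCot]
  congr 2
  field_simp
  ring

lemma sApprox_eq_sum {n : ℕ} (hn : 0 < n) {x : ℝ} (hx : x ∈ Ico (0 : ℝ) 1) (y : ℝ) :
    sApprox (2 * n) x y = ∑ l ∈ symmResidues (fibQ (2 * n)),
      convInd (2 * n) x l * scaledCot (fibQ (2 * n))
        (l + (y - convDefect (2 * n) * Int.fract (l * fibConv (2 * n)))) := by
  have hq0 : 0 < fibQ (2 * n) := fibQ_pos (by omega)
  have hqr : (fibQ (2 * n) : ℝ) ≠ 0 := by exact_mod_cast hq0.ne'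
  rw [sApprox, cotBirkhoffSum, Finset.sum_div]
  refine sum_Icc_eq_sum_symmResidues hn hx _ _ fun k l _ _ hkl hfr => ?_
  obtain ⟨c, hc⟩ := hkl.dvd
  have hc' : (l : ℝ) - k * fibP (2 * n) = fibQ (2 * n) * c := by exact_mod_cast hc
  have e : (l : ℝ) + (y - convDefect (2 * n) * Int.fract (l * fibConv (2 * n))) =
      (k * fibP (2 * n) + (y - convDefect (2 * n) * (k / fibQ (2 * n)))) + fibQ (2 * n) * c := by
    rw [hfr]; linarith
  rw [e, scaledCot_add_int_mul hq0, scaledCot]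
  congr 2
  rw [goldenAlpha_eq_fibConv_sub (by omega : 0 < 2 * n), fibConv]
  field_simp
  ring

/-- Summation by parts against the clamped cotangent. -/
lemma sum_clampedCot_mul {q : ℕ} (hq : 0 < q) (f : ℕ → ℝ) :
    ∑ i ∈ Finset.range (q / 2), clampedCot q (i + 1) * f i =
      ∑ i ∈ Finset.range (q / 2), (clampedCot q (i + 1) - clampedCot q (i + 2)) *
        ∑ j ∈ Finset.range (i + 1), f j := by
  have key : ∀ h : ℕ, ∑ i ∈ Finset.range h, clampedCot q (i + 1) * f i =
      ∑ i ∈ Finset.range h, (clampedCot q (i + 1) - clampedCot q (i + 2)) *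
        ∑ j ∈ Finset.range (i + 1), f j + clampedCot q (h + 1) * ∑ j ∈ Finset.range h, f j := by
    intro h
    induction h with
    | zero => simp
    | succ h ih =>
      rw [Finset.sum_range_succ, ih, Finset.sum_range_succ _ h, Finset.sum_range_succ f h]
      ring
  -- Clamping at the zero q/2 kills the boundary term for either parity of q.
  have hlast : clampedCot q (q / 2 + 1) = 0 := by
    rw [clampedCot, min_eq_right, scaledCot_half hq]
    have : q ≤ 2 * (q / 2 + 1) := by omega
    have h2 : (q : ℝ) ≤ 2 * ((q / 2 + 1 : ℕ) : ℝ) := by exact_mod_cast this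
    linarith
  rw [key, hlast, zero_mul, add_zero]

/-- The signed counting function of `c` on `±1, …, ±N`. -/
noncomputable def oddPartialSum (c : ℤ → ℝ) (N : ℕ) : ℝ :=
  ∑ i ∈ Finset.range N, (c (i + 1) - c (-(i + 1)))

lemma sum_Icc_neg_eq (F : ℤ → ℝ) (h : ℕ) (h0 : F 0 = 0) :
    ∑ l ∈ Finset.Icc (-(h : ℤ)) h, F l =
      ∑ i ∈ Finset.range h, (F (i + 1) + F (-(i + 1))) := by
  induction h with
  | zero => simp [h0]
  | succ h ih =>
    rw [Finset.sum_range_succ, ← ih]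
    have e : Finset.Icc (-((h + 1 : ℕ) : ℤ)) ((h + 1 : ℕ) : ℤ) =
        insert ((h : ℤ) + 1) (insert (-((h : ℤ) + 1)) (Finset.Icc (-(h : ℤ)) h)) := by
      ext l
      simp only [Finset.mem_insert, Finset.mem_Icc]
      push_cast
      omega
    rw [e, Finset.sum_insert, Finset.sum_insert]
    · ring
    · simp only [Finset.mem_Icc]; omega
    · simp only [Finset.mem_insert, Finset.mem_Icc]; omega

lemma sum_symmResidues_mul_scaledCot {q : ℕ} (hq : 0 < q) (c : ℤ → ℝ) :
    ∑ l ∈ symmResidues q, c l * scaledCot q l =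
      ∑ i ∈ Finset.range (q / 2), (clampedCot q (i + 1) - clampedCot q (i + 2)) *
        oddPartialSum c (i + 1) := by
  have h1 : ∑ l ∈ symmResidues q, c l * scaledCot q l =
      ∑ l ∈ Finset.Icc (-((q / 2 : ℕ) : ℤ)) ((q / 2 : ℕ) : ℤ), c l * scaledCot q l := by
    refine Finset.sum_subset ?_ ?_
    · intro l hl
      rw [symmResidues, Finset.mem_Ico] at hl
      rw [Finset.mem_Icc]
      omega
    -- Only l = q/2 with q even is added, and the cotangent vanishes there.
    · intro l hl hl'
      rw [symmResidues, Finset.mem_Ico] at hl'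
      rw [Finset.mem_Icc] at hl
      have h2 : 2 * l = q := by omega
      have h3 : (l : ℝ) = q / 2 := by
        have : (2 : ℝ) * l = q := by exact_mod_cast h2
        linarith
      rw [h3, scaledCot_half hq, mul_zero]
  -- The term l = 0 drops out because division by zero makes the cotangent 0 at its pole.
  rw [h1, sum_Icc_neg_eq _ _ (by simp [scaledCot_zero])]
  unfold oddPartialSum
  rw [← sum_clampedCot_mul hq]
  refine Finset.sum_congr rfl fun i hi => ?_
  have hi' : i + 1 ≤ q / 2 := Finset.mem_range.1 hi
  have h2 : clampedCot q (i + 1) = scaledCot q (i + 1) := by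
    rw [clampedCot, min_eq_left]
    · push_cast; rfl
    · have : 2 * (i + 1) ≤ q := by omega
      have h3 : (2 : ℝ) * ((i + 1 : ℕ) : ℝ) ≤ q := by exact_mod_cast this
      linarith
  push_cast
  rw [h2, scaledCot_neg]
  ring

/-- The main terms Nx of the positive and negative halves cancel, leaving two discrepancies. -/
lemma abs_oddPartialSum_convInd_le {n : ℕ} {x : ℝ} (hx : x ∈ Ico (0 : ℝ) 1) {N : ℕ}
    (hN : N < fibQ n) : |oddPartialSum (convInd n x) N| ≤ 40 * Real.sqrt N := by
  have h1 := abs_visits_sub_le hx N hN 1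
  have h2 := abs_visits_sub_le hx N hN (-N)
  have e1 : ∑ i ∈ Finset.range N, convInd n x (i + 1) = visits n x 1 N := by
    refine Finset.sum_congr rfl fun i _ => ?_
    have : ((i : ℤ) + 1) ≠ 0 := by omega
    rw [convInd, add_comm (i : ℤ)] at *
    simp only [this, ne_eq, not_false_eq_true, true_and]
  have e2 : ∑ i ∈ Finset.range N, convInd n x (-(i + 1)) = visits n x (-N) N := by
    rw [visits, ← Finset.sum_range_reflect]
    refine Finset.sum_congr rfl fun i hi => ?_
    have hi' := Finset.mem_range.1 hi
    have h3 : -(((N - 1 - i : ℕ) : ℤ) + 1) = -N + i := by omega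
    have h4 : (-N + i : ℤ) ≠ 0 := by omega
    rw [h3, convInd]
    simp only [h4, ne_eq, not_false_eq_true, true_and]
  rw [oddPartialSum, Finset.sum_sub_distrib, e1, e2]
  rw [abs_le] at *
  constructor <;> linarith

/-! ### The limiting series -/

/-- The constant term: `∑ l, c l / (π l)` summed by parts over symmetric ranges. -/
noncomputable def oddSeries (c : ℤ → ℝ) : ℝ :=
  ∑' i : ℕ, (1 / (Real.pi * (i + 1)) - 1 / (Real.pi * (i + 2))) * oddPartialSum c (i + 1)

/-- The series `∑ l, c l (1 / (π (l + z l)) - 1 / (π l))`. -/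
noncomputable def perturbedSeries (c : ℤ → ℝ) (z : ℤ → ℝ) : ℝ :=
  ∑' l : ℤ, c l * (1 / (Real.pi * (l + z l)) - 1 / (Real.pi * l))

lemma sqrt_div_sq_eq {t : ℝ} (ht : 0 < t) : 1 / t ^ 2 * Real.sqrt t = 1 / t ^ (3 / 2 : ℝ) := by
  have h := Real.rpow_pos_of_pos ht (3 / 2)
  rw [div_mul_eq_mul_div, one_mul, div_eq_div_iff (by positivity) h.ne', Real.sqrt_eq_rpow,
    ← Real.rpow_add ht, one_mul, ← Real.rpow_two]
  norm_num

lemma summable_sqrt_div_sq (C : ℝ) :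
    Summable fun i : ℕ => C * (1 / ((i + 1 : ℕ) : ℝ) ^ 2 * Real.sqrt ((i + 1 : ℕ) : ℝ)) := by
  refine Summable.mul_left _ ?_
  have h := (summable_nat_add_iff 1).2
    (Real.summable_one_div_nat_rpow.2 (by norm_num : (1 : ℝ) < 3 / 2))
  refine h.congr fun i => ?_
  exact (sqrt_div_sq_eq (by positivity)).symm

lemma summable_const_div_int_sq (C : ℝ) : Summable fun l : ℤ => C * (1 / (l : ℝ) ^ 2) :=
  (Real.summable_one_div_int_pow.2 one_lt_two).mul_left _

lemma abs_weight_le (i : ℕ) :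
    |1 / (Real.pi * ((i : ℝ) + 1)) - 1 / (Real.pi * (i + 2))| ≤
      1 * (1 / ((i + 1 : ℕ) : ℝ) ^ 2) := by
  have hpi := Real.pi_gt_three
  have h1 : 1 / (Real.pi * ((i : ℝ) + 1)) - 1 / (Real.pi * (i + 2)) =
      1 / (Real.pi * ((i + 1) * (i + 2))) := by
    have := hpi.ne'
    field_simp
    ring
  rw [h1, abs_of_nonneg (by positivity), one_mul]
  push_cast
  apply one_div_le_one_div_of_le (by positivity)
  have : (0 : ℝ) ≤ i := Nat.cast_nonneg i
  nlinarith [mul_nonneg this this]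

lemma abs_perturbed_term_le {c : ℤ → ℝ} (hc : ∀ l, |c l| ≤ 1) (hc0 : c 0 = 0)
    {z : ℤ → ℝ} {ρ : ℝ} (hρ : ρ < 1) (hz : ∀ l, |z l| ≤ ρ) (l : ℤ) :
    ‖c l * (1 / (Real.pi * (l + z l)) - 1 / (Real.pi * l))‖ ≤
      1 / (1 - ρ) * (1 / (l : ℝ) ^ 2) := by
  rcases eq_or_ne l 0 with rfl | hl
  · simp [hc0]
  have hpi := Real.pi_gt_three
  have hl1 : (1 : ℝ) ≤ |(l : ℝ)| := by exact_mod_cast Int.one_le_abs hl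
  have hl0 : (l : ℝ) ≠ 0 := by exact_mod_cast hl
  have hz0 := abs_nonneg (z l)
  have hzl := hz l
  have h1 : (1 - ρ) * |(l : ℝ)| ≤ |(l : ℝ) + z l| := by
    have := abs_sub_abs_le_abs_sub (l : ℝ) (-z l)
    rw [abs_neg, sub_neg_eq_add] at this
    nlinarith
  have h2 : 0 < (1 - ρ) * |(l : ℝ)| := mul_pos (by linarith) (by linarith)
  have h3 : (l : ℝ) + z l ≠ 0 := abs_pos.1 (h2.trans_le h1)
  have e : 1 / (Real.pi * (l + z l)) - 1 / (Real.pi * l) =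
      -z l / (Real.pi * ((l + z l) * l)) := by
    have := hpi.ne'
    field_simp
    ring
  rw [Real.norm_eq_abs, abs_mul, e, abs_div, abs_mul, abs_mul, abs_neg,
    abs_of_pos Real.pi_pos]
  calc |c l| * (|z l| / (Real.pi * (|(l : ℝ) + z l| * |(l : ℝ)|)))
      ≤ 1 * (1 / (1 * (((1 - ρ) * |(l : ℝ)|) * |(l : ℝ)|))) := by
        gcongr
        · exact hc l
        · linarith
        · linarith
    _ = 1 / (1 - ρ) * (1 / |(l : ℝ)| ^ 2) := by
        have : 1 - ρ ≠ 0 := by linarith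
        field_simp
    _ = _ := by rw [sq_abs]

lemma summable_perturbed {c : ℤ → ℝ} (hc : ∀ l, |c l| ≤ 1) (hc0 : c 0 = 0)
    {z : ℤ → ℝ} {ρ : ℝ} (hρ : ρ < 1) (hz : ∀ l, |z l| ≤ ρ) :
    Summable fun l : ℤ => c l * (1 / (Real.pi * (l + z l)) - 1 / (Real.pi * l)) :=
  Summable.of_norm_bounded (summable_const_div_int_sq _) (abs_perturbed_term_le hc hc0 hρ hz)

lemma tendsto_oddPartialSum {ι : Type*} {F : Filter ι} {c : ι → ℤ → ℝ} {d : ℤ → ℝ}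
    (h : ∀ l, Tendsto (fun i => c i l) F (𝓝 (d l))) (N : ℕ) :
    Tendsto (fun i => oddPartialSum (c i) N) F (𝓝 (oddPartialSum d N)) :=
  tendsto_finsetSum _ fun j _ => (h (j + 1)).sub (h (-(j + 1)))

/-- Weights O(i⁻²) against partial sums O(√i) give the summable majorant i^(-3/2). -/
lemma tendsto_oddSeries {ι : Type*} {F : Filter ι} {c : ι → ℤ → ℝ} {d : ℤ → ℝ} {K : ℝ}
    (h : ∀ l, Tendsto (fun i => c i l) F (𝓝 (d l)))
    (hK : ∀ᶠ i in F, ∀ N : ℕ, |oddPartialSum (c i) N| ≤ K * Real.sqrt N) :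
    Tendsto (fun i => oddSeries (c i)) F (𝓝 (oddSeries d)) := by
  refine tendsto_tsum_of_dominated_convergence (summable_sqrt_div_sq K)
    (fun k => (tendsto_oddPartialSum h (k + 1)).const_mul _) ?_
  filter_upwards [hK] with i hi k
  have h1 := abs_weight_le k
  have h2 := hi (k + 1)
  rw [Real.norm_eq_abs, abs_mul]
  calc _ ≤ (1 * (1 / ((k + 1 : ℕ) : ℝ) ^ 2)) * (K * Real.sqrt ((k + 1 : ℕ) : ℝ)) :=
        mul_le_mul h1 h2 (abs_nonneg _) (by positivity)
    _ = _ := by ring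

lemma tendsto_perturbedSeries {ι : Type*} {F : Filter ι} {c : ι → ℤ → ℝ} {d : ℤ → ℝ}
    (h : ∀ l, Tendsto (fun i => c i l) F (𝓝 (d l)))
    (hc : ∀ᶠ i in F, ∀ l, |c i l| ≤ 1) (hc0 : ∀ᶠ i in F, c i 0 = 0)
    {z : ℤ → ℝ} {ρ : ℝ} (hρ : ρ < 1) (hz : ∀ l, |z l| ≤ ρ) :
    Tendsto (fun i => perturbedSeries (c i) z) F (𝓝 (perturbedSeries d z)) := by
  refine tendsto_tsum_of_dominated_convergence (summable_const_div_int_sq (1 / (1 - ρ)))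
    (fun l => (h l).mul_const _) ?_
  filter_upwards [hc, hc0] with i hi hi0 l
  exact abs_perturbed_term_le hi hi0 hρ hz l

lemma tendsto_sum_scaledCot {Q : ℕ → ℕ} (hQ : Tendsto Q atTop atTop) {c : ℕ → ℤ → ℝ} {d : ℤ → ℝ}
    {K : ℝ} (h : ∀ l, Tendsto (fun n => c n l) atTop (𝓝 (d l)))
    (hK : ∀ n, ∀ N : ℕ, N < Q n → |oddPartialSum (c n) N| ≤ K * Real.sqrt N) :
    Tendsto (fun n => ∑ l ∈ symmResidues (Q n), c n l * scaledCot (Q n) l) atTop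
      (𝓝 (oddSeries d)) := by
  have hw (k : ℕ) : Tendsto (fun n => clampedCot (Q n) (k + 1)) atTop
      (𝓝 (1 / (Real.pi * (k + 1)))) := by
    have hk : ((k : ℝ) + 1) ≠ 0 := by positivity
    refine (tendsto_scaledCot hQ tendsto_const_nhds hk).congr' ?_
    filter_upwards [hQ.eventually_ge_atTop (2 * (k + 1))] with n hn
    rw [clampedCot, min_eq_left]
    · push_cast; rfl
    · have : (2 : ℝ) * ((k + 1 : ℕ) : ℝ) ≤ Q n := by exact_mod_cast hn
      linarith
  have hw2 (k : ℕ) : Tendsto (fun n => clampedCot (Q n) (k + 2)) atTop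
      (𝓝 (1 / (Real.pi * (k + 2)))) := by
    have := hw (k + 1)
    push_cast at this
    have e : (k : ℝ) + 1 + 1 = k + 2 := by ring
    rwa [e] at this
  -- The finite sums are extended by zero to a fixed index set so that dominated convergence
  -- applies.
  have hlim : Tendsto (fun n => ∑' i : ℕ, if i < Q n / 2 then
      (clampedCot (Q n) (i + 1) - clampedCot (Q n) (i + 2)) * oddPartialSum (c n) (i + 1) else 0)
      atTop (𝓝 (oddSeries d)) := by
    refine tendsto_tsum_of_dominated_convergence (summable_sqrt_div_sq (Real.pi / 4 * K)) ?_ ?_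
    · intro k
      refine (((hw k).sub (hw2 k)).mul (tendsto_oddPartialSum h (k + 1))).congr' ?_
      filter_upwards [hQ.eventually_ge_atTop (2 * (k + 1))] with n hn
      rw [if_pos (by omega)]
    · filter_upwards [hQ.eventually_ge_atTop 2] with n hn k
      have hK0 : 0 ≤ K := by
        have := (abs_nonneg _).trans (hK n 1 (by omega))
        simpa using this
      split_ifs with hk
      · have h1 := abs_clampedCot_sub_le hn k
        have h2 := hK n (k + 1) (by omega)
        rw [Real.norm_eq_abs, abs_mul]
        have hpi := Real.pi_pos
        calc _ ≤ (Real.pi / 4 * (1 / ((k + 1 : ℕ) : ℝ) ^ 2)) *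
              (K * Real.sqrt ((k + 1 : ℕ) : ℝ)) :=
            mul_le_mul h1 h2 (abs_nonneg _) (by positivity)
          _ = _ := by ring
      · have hpi := Real.pi_pos
        rw [norm_zero]
        positivity
  refine hlim.congr' ?_
  filter_upwards [hQ.eventually_ge_atTop 1] with n hn
  rw [sum_symmResidues_mul_scaledCot hn, tsum_eq_sum (s := Finset.range (Q n / 2))]
  · exact Finset.sum_congr rfl fun i hi => if_pos (Finset.mem_range.1 hi)
  · intro i hi
    exact if_neg (by rwa [Finset.mem_range] at hi)

lemma tendsto_sum_scaledCot_sub {Q : ℕ → ℕ} (hQ : Tendsto Q atTop atTop) {c : ℕ → ℤ → ℝ}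
    {d : ℤ → ℝ} (h : ∀ l, Tendsto (fun n => c n l) atTop (𝓝 (d l)))
    (hc : ∀ n l, |c n l| ≤ 1) (hc0 : ∀ n, c n 0 = 0) {z : ℕ → ℤ → ℝ} {w : ℤ → ℝ} {ρ : ℝ}
    (hρ : ρ < 1) (hz : ∀ n l, |z n l| ≤ ρ)
    (hzw : ∀ l, Tendsto (fun n => z n l) atTop (𝓝 (w l))) :
    Tendsto (fun n => ∑ l ∈ symmResidues (Q n),
      c n l * (scaledCot (Q n) (l + z n l) - scaledCot (Q n) l)) atTop
      (𝓝 (perturbedSeries d w)) := by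
  have hρ0 : 0 ≤ ρ := (abs_nonneg _).trans (hz 0 0)
  have hd0 : d 0 = 0 := by
    have := h 0
    simp only [hc0] at this
    exact (tendsto_nhds_unique this tendsto_const_nhds)
  have hlim : Tendsto (fun n => ∑' l : ℤ, if l ∈ symmResidues (Q n) then
      c n l * (scaledCot (Q n) (l + z n l) - scaledCot (Q n) l) else 0) atTop
      (𝓝 (perturbedSeries d w)) := by
    refine tendsto_tsum_of_dominated_convergence
      (summable_const_div_int_sq (Real.pi / (2 * (1 - ρ)))) ?_ ?_
    · intro l
      rcases eq_or_ne l 0 with rfl | hl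
      · simp [hc0, hd0]
      have hl0 : (l : ℝ) ≠ 0 := by exact_mod_cast hl
      have hl1 : (1 : ℝ) ≤ |(l : ℝ)| := by exact_mod_cast Int.one_le_abs hl
      have hwl : |w l| ≤ ρ := le_of_tendsto (hzw l).abs (Eventually.of_forall fun n => hz n l)
      have hlw : (l : ℝ) + w l ≠ 0 := by
        intro h0
        have : (l : ℝ) = -w l := by linarith
        rw [this, abs_neg] at hl1
        linarith
      refine ((h l).mul ((tendsto_scaledCot hQ ((hzw l).const_add (l : ℝ)) hlw).sub
        (tendsto_scaledCot hQ tendsto_const_nhds hl0))).congr' ?_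
      filter_upwards [hQ.eventually_ge_atTop (2 * l.natAbs + 2)] with n hn
      rw [if_pos]
      rw [symmResidues, Finset.mem_Ico]
      omega
    · filter_upwards [hQ.eventually_ge_atTop 4] with n hn l
      have hb : 0 ≤ Real.pi / (2 * (1 - ρ)) * (1 / (l : ℝ) ^ 2) :=
        mul_nonneg (div_nonneg Real.pi_pos.le (by linarith)) (by positivity)
      split_ifs with hl
      · rcases eq_or_ne l 0 with rfl | hl0
        · simp [hc0]
        have h1 := abs_scaledCot_sub_le hn (two_mul_abs_le_of_mem_symmResidues hl) hl0 hρ (hz n l)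
        rw [Real.norm_eq_abs, abs_mul]
        calc _ ≤ 1 * (Real.pi / (2 * (1 - ρ)) * (1 / (l : ℝ) ^ 2)) :=
              mul_le_mul (hc n l) h1 (abs_nonneg _) zero_le_one
          _ = _ := one_mul _
      · rwa [norm_zero]
  refine hlim.congr fun n => ?_
  rw [tsum_eq_sum (s := symmResidues (Q n))]
  · exact Finset.sum_congr rfl fun i hi => if_pos hi
  · intro i hi
    exact if_neg hi

lemma tendsto_sum_scaledCot_perturbed {Q : ℕ → ℕ} (hQ : Tendsto Q atTop atTop) {c : ℕ → ℤ → ℝ}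
    {d : ℤ → ℝ} {K : ℝ} (h : ∀ l, Tendsto (fun n => c n l) atTop (𝓝 (d l)))
    (hK : ∀ n, ∀ N : ℕ, N < Q n → |oddPartialSum (c n) N| ≤ K * Real.sqrt N)
    (hc : ∀ n l, |c n l| ≤ 1) (hc0 : ∀ n, c n 0 = 0) {z : ℕ → ℤ → ℝ} {w : ℤ → ℝ} {ρ : ℝ}
    (hρ : ρ < 1) (hz : ∀ n l, |z n l| ≤ ρ)
    (hzw : ∀ l, Tendsto (fun n => z n l) atTop (𝓝 (w l))) :
    Tendsto (fun n => ∑ l ∈ symmResidues (Q n), c n l * scaledCot (Q n) (l + z n l)) atTop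
      (𝓝 (oddSeries d + perturbedSeries d w)) := by
  refine ((tendsto_sum_scaledCot hQ h hK).add
    (tendsto_sum_scaledCot_sub hQ h hc hc0 hρ hz hzw)).congr fun n => ?_
  rw [← Finset.sum_add_distrib]
  exact Finset.sum_congr rfl fun l _ => by ring

/-! ### Analyticity in the second variable -/

/-- The complexified series converges uniformly on a disc of radius ρ < 1, so it is holomorphic
there; on the real axis its real part is the given series. -/
lemma analyticAt_perturbedSeries {c : ℤ → ℝ} (hc : ∀ l, |c l| ≤ 1) (hc0 : c 0 = 0) {y : ℝ}
    (hy : y ∈ Ioo (-1 : ℝ) 1) :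
    AnalyticAt ℝ (fun y : ℝ => perturbedSeries c fun _ => y) y := by
  have hy1 : |y| < 1 := abs_lt.2 hy
  obtain ⟨ρ, hyρ, hρ⟩ := exists_between hy1
  set G : ℂ → ℂ := fun w => ∑' l : ℤ, (c l : ℂ) *
    (1 / ((Real.pi : ℂ) * (l + w)) - 1 / ((Real.pi : ℂ) * l)) with hG
  have hpi : (Real.pi : ℂ) ≠ 0 := by exact_mod_cast Real.pi_pos.ne'
  have hlow : ∀ l : ℤ, l ≠ 0 → ∀ w ∈ Metric.ball (0 : ℂ) ρ,
      (1 - ρ) * |(l : ℝ)| ≤ ‖(l : ℂ) + w‖ := by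
    intro l hl w hw
    rw [mem_ball_zero_iff] at hw
    have hl1 : (1 : ℝ) ≤ |(l : ℝ)| := by exact_mod_cast Int.one_le_abs hl
    have h1 := norm_sub_norm_le (l : ℂ) (-w)
    rw [norm_neg, sub_neg_eq_add, Complex.norm_intCast] at h1
    have := norm_nonneg w
    nlinarith
  have hne : ∀ l : ℤ, l ≠ 0 → ∀ w ∈ Metric.ball (0 : ℂ) ρ, (l : ℂ) + w ≠ 0 := by
    intro l hl w hw
    have hl1 : (1 : ℝ) ≤ |(l : ℝ)| := by exact_mod_cast Int.one_le_abs hl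
    exact norm_pos_iff.1 ((mul_pos (by linarith) (by linarith)).trans_le (hlow l hl w hw))
  have hdiff : DifferentiableOn ℂ G (Metric.ball 0 ρ) := by
    refine Complex.differentiableOn_tsum_of_summable_norm
      (summable_const_div_int_sq (1 / (1 - ρ))) ?_ Metric.isOpen_ball ?_
    · intro l
      rcases eq_or_ne l 0 with rfl | hl
      · simp [hc0]
      intro w hw
      have h1 := mul_ne_zero hpi (hne l hl w hw)
      refine DifferentiableAt.differentiableWithinAt ?_
      fun_prop (disch := assumption)
    · intro l w hw
      rcases eq_or_ne l 0 with rfl | hl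
      · simp [hc0]
      have hl1 : (1 : ℝ) ≤ |(l : ℝ)| := by exact_mod_cast Int.one_le_abs hl
      have h1 := hlow l hl w hw
      have h2 := hne l hl w hw
      have hl0 : (l : ℂ) ≠ 0 := by exact_mod_cast hl
      have h3 : 0 < (1 - ρ) * |(l : ℝ)| := mul_pos (by linarith) (by linarith)
      have h4 := Real.pi_gt_three
      rw [mem_ball_zero_iff] at hw
      have e : 1 / ((Real.pi : ℂ) * (l + w)) - 1 / ((Real.pi : ℂ) * l) =
          -w / ((Real.pi : ℂ) * ((l + w) * l)) := by
        field_simp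
        ring
      rw [e, norm_mul, norm_div, norm_mul, norm_mul, norm_neg, Complex.norm_intCast,
        Complex.norm_real, Complex.norm_real, Real.norm_eq_abs, Real.norm_eq_abs,
        abs_of_pos Real.pi_pos]
      calc |c l| * (‖w‖ / (Real.pi * (‖(l : ℂ) + w‖ * |(l : ℝ)|)))
          ≤ 1 * (1 / (1 * (((1 - ρ) * |(l : ℝ)|) * |(l : ℝ)|))) := by
            gcongr
            · exact hc l
            · linarith
            · linarith
        _ = 1 / (1 - ρ) * (1 / |(l : ℝ)| ^ 2) := by
            have : 1 - ρ ≠ 0 := by linarith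
            field_simp
        _ = _ := by rw [sq_abs]
  have hGy : AnalyticAt ℂ G (y : ℂ) := by
    refine hdiff.analyticAt (Metric.isOpen_ball.mem_nhds ?_)
    rw [mem_ball_zero_iff, Complex.norm_real]
    exact hyρ
  have hre : AnalyticAt ℝ (fun t : ℝ => (G t).re) y := hGy.re_ofReal
  refine hre.congr (Eventually.of_forall fun t => ?_)
  have : G t = ((perturbedSeries c fun _ => t : ℝ) : ℂ) := by
    rw [hG, perturbedSeries, Complex.ofReal_tsum]
    push_cast
    rfl
  simp only [this, Complex.ofReal_re]

/-! ### The limiting indicators -/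

/-- The pointwise limit of the indicators `convInd (2 * n) x`. -/
noncomputable def limInd (x : ℝ) (l : ℤ) : ℝ :=
  if l ≠ 0 ∧ (Int.fract (l * goldenAlpha) < x ∨ Int.fract (l * goldenAlpha) = x ∧ l < 0)
  then 1 else 0

/-- The right limit of `limInd` in `x`. -/
noncomputable def limIndRight (x : ℝ) (l : ℤ) : ℝ :=
  if l ≠ 0 ∧ Int.fract (l * goldenAlpha) ≤ x then 1 else 0

lemma abs_ite_one_zero_le (p : Prop) [Decidable p] : |(if p then (1 : ℝ) else 0)| ≤ 1 := by
  split_ifs <;> simp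

lemma fract_add_of_mem {a w : ℝ} (h0 : 0 ≤ Int.fract a + w) (h1 : Int.fract a + w < 1) :
    Int.fract (a + w) = Int.fract a + w := by
  rw [Int.fract_eq_iff]
  refine ⟨h0, h1, ⌊a⌋, ?_⟩
  rw [Int.fract]
  ring

lemma fract_int_mul_goldenAlpha_pos {l : ℤ} (hl : l ≠ 0) : 0 < Int.fract (l * goldenAlpha) := by
  refine (Int.fract_nonneg _).lt_of_ne fun h => ?_
  obtain ⟨z, hz⟩ := Int.fract_eq_zero_iff.1 h.symm
  exact (irrational_goldenAlpha.intCast_mul hl).ne_int z hz.symm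

lemma fract_int_mul_goldenAlpha_injective {l m : ℤ}
    (h : Int.fract (l * goldenAlpha) = Int.fract (m * goldenAlpha)) : l = m := by
  by_contra hne
  obtain ⟨z, hz⟩ := Int.fract_eq_fract.1 h
  refine (irrational_goldenAlpha.intCast_mul (sub_ne_zero.2 hne)).ne_int z ?_
  push_cast
  linarith

lemma tendsto_fibQ_even : Tendsto (fun n : ℕ => fibQ (2 * (n + 1))) atTop atTop := by
  refine tendsto_atTop_mono (fun n => ?_) tendsto_id
  have h : 2 * (n + 1) ≤ fibQ (2 * (n + 1)) + 1 := Nat.le_fib_add_one _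
  simp only [id]
  omega

lemma fibConv_even_sub_pos {n : ℕ} (hn : 0 < n) : 0 < fibConv (2 * n) - goldenAlpha := by
  rw [fibConv_sub_goldenAlpha (by omega)]
  have hq : (0 : ℝ) < fibQ (2 * n) := by exact_mod_cast fibQ_pos (by omega)
  exact div_pos ((even_two_mul n).pow_pos Real.goldenConj_ne_zero) hq

lemma tendsto_fibConv_even_sub :
    Tendsto (fun n : ℕ => fibConv (2 * (n + 1)) - goldenAlpha) atTop (𝓝 0) := by
  have hQ : Tendsto (fun n : ℕ => (fibQ (2 * (n + 1)) : ℝ)) atTop atTop :=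
    tendsto_natCast_atTop_atTop.comp tendsto_fibQ_even
  have hQ2 := hQ.atTop_mul_atTop₀ hQ
  have h := (tendsto_convDefect_even.comp (tendsto_add_atTop_nat 1)).div_atTop hQ2
  refine h.congr fun n => ?_
  have := goldenAlpha_eq_fibConv_sub (by omega : 0 < 2 * (n + 1))
  rw [Function.comp_apply, this]
  ring

/-- By irrationality {lα} is interior to (0,1), so a small perturbation does not wrap around. -/
lemma eventually_fract_mul_fibConv {l : ℤ} (hl : l ≠ 0) :
    ∀ᶠ n : ℕ in atTop, Int.fract (l * fibConv (2 * (n + 1))) =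
      Int.fract (l * goldenAlpha) + l * (fibConv (2 * (n + 1)) - goldenAlpha) := by
  have h := (tendsto_fibConv_even_sub.const_mul (l : ℝ)).const_add (Int.fract (l * goldenAlpha))
  rw [mul_zero, add_zero] at h
  filter_upwards [h.eventually_const_lt (fract_int_mul_goldenAlpha_pos hl),
    h.eventually_lt_const (Int.fract_lt_one _)] with n h0 h1
  rw [← fract_add_of_mem h0.le h1]
  congr 1
  ring

lemma tendsto_fract_mul_fibConv (l : ℤ) :
    Tendsto (fun n : ℕ => Int.fract (l * fibConv (2 * (n + 1)))) atTop
      (𝓝 (Int.fract (l * goldenAlpha))) := by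
  rcases eq_or_ne l 0 with rfl | hl
  · simp
  have h := (tendsto_fibConv_even_sub.const_mul (l : ℝ)).const_add (Int.fract (l * goldenAlpha))
  rw [mul_zero, add_zero] at h
  exact h.congr' ((eventually_fract_mul_fibConv hl).mono fun n hn => hn.symm)

/-- Even convergents exceed α, so {lp/q} tends to {lα} from above for l > 0 and from below for l <
0. This settles the tie {lα} = x. -/
lemma tendsto_convInd (x : ℝ) (l : ℤ) :
    Tendsto (fun n : ℕ => convInd (2 * (n + 1)) x l) atTop (𝓝 (limInd x l)) := by
  rcases eq_or_ne l 0 with rfl | hl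
  · simp [convInd, limInd]
  have h := tendsto_fract_mul_fibConv l
  refine tendsto_const_nhds.congr' ?_
  rcases lt_trichotomy (Int.fract (l * goldenAlpha)) x with hx | hx | hx
  · filter_upwards [h.eventually_lt_const hx] with n hn
    rw [limInd, convInd, if_pos ⟨hl, Or.inl hx⟩, if_pos ⟨hl, hn.le⟩]
  · filter_upwards [eventually_fract_mul_fibConv hl] with n hn
    have hpos := fibConv_even_sub_pos (Nat.succ_pos n)
    rw [limInd, convInd, hn, hx]
    refine if_congr ?_ rfl rfl
    rcases lt_or_gt_of_ne hl with hl' | hl'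
    · have : (l : ℝ) < 0 := by exact_mod_cast hl'
      have h1 := mul_neg_of_neg_of_pos this hpos
      rw [Nat.succ_eq_add_one] at h1
      simp [hl, hl', h1.le]
    · have : (0 : ℝ) < l := by exact_mod_cast hl'
      have h1 := mul_pos this hpos
      rw [Nat.succ_eq_add_one] at h1
      simp [not_lt.2 hl'.le, not_le.2 h1]
  · filter_upwards [h.eventually_const_lt hx] with n hn
    rw [limInd, convInd, if_neg, if_neg]
    · exact fun h => absurd h.2 (not_le.2 hn)
    · rintro ⟨-, h | h⟩ <;> linarith

lemma tendsto_limInd_right (x : ℝ) (l : ℤ) :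
    Tendsto (fun u => limInd u l) (𝓝[>] x) (𝓝 (limIndRight x l)) := by
  refine tendsto_const_nhds.congr' ?_
  rcases le_or_gt (Int.fract (l * goldenAlpha)) x with hx | hx
  · filter_upwards [self_mem_nhdsWithin] with u hu
    have hu' := hx.trans_lt hu
    simp [limInd, limIndRight, hx, hu']
  · filter_upwards [Ioo_mem_nhdsGT hx] with u hu
    simp [limInd, limIndRight, not_le.2 hx, not_lt.2 hu.2.le, hu.2.ne']

lemma tendsto_limIndRight_right (x : ℝ) (l : ℤ) :
    Tendsto (fun u => limIndRight u l) (𝓝[>] x) (𝓝 (limIndRight x l)) := by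
  refine tendsto_const_nhds.congr' ?_
  rcases le_or_gt (Int.fract (l * goldenAlpha)) x with hx | hx
  · filter_upwards [self_mem_nhdsWithin] with u hu
    have hu' := (hx.trans_lt hu).le
    simp [limIndRight, hx, hu']
  · filter_upwards [Ioo_mem_nhdsGT hx] with u hu
    simp [limIndRight, not_le.2 hx, not_le.2 hu.2]

lemma abs_limInd_le (x : ℝ) (l : ℤ) : |limInd x l| ≤ 1 := abs_ite_one_zero_le _

lemma abs_limIndRight_le (x : ℝ) (l : ℤ) : |limIndRight x l| ≤ 1 := abs_ite_one_zero_le _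

lemma limInd_zero (x : ℝ) : limInd x 0 = 0 := by simp [limInd]

lemma limIndRight_zero (x : ℝ) : limIndRight x 0 = 0 := by simp [limIndRight]

lemma eventually_mem_Ico_right {x : ℝ} (hx : x ∈ Ico (0 : ℝ) 1) :
    ∀ᶠ u in 𝓝[>] x, u ∈ Ico (0 : ℝ) 1 := by
  filter_upwards [Ioo_mem_nhdsGT hx.2] with u hu
  exact ⟨hx.1.trans hu.1.le, hu.2⟩

lemma abs_oddPartialSum_limInd_le {x : ℝ} (hx : x ∈ Ico (0 : ℝ) 1) (N : ℕ) :
    |oddPartialSum (limInd x) N| ≤ 40 * Real.sqrt N := by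
  refine le_of_tendsto (tendsto_oddPartialSum (tendsto_convInd x) N).abs ?_
  filter_upwards [tendsto_fibQ_even.eventually_gt_atTop N] with n hn
  exact abs_oddPartialSum_convInd_le hx hn

lemma abs_oddPartialSum_limIndRight_le {x : ℝ} (hx : x ∈ Ico (0 : ℝ) 1) (N : ℕ) :
    |oddPartialSum (limIndRight x) N| ≤ 40 * Real.sqrt N := by
  refine le_of_tendsto (tendsto_oddPartialSum (tendsto_limInd_right x) N).abs ?_
  filter_upwards [eventually_mem_Ico_right hx] with u hu
  exact abs_oddPartialSum_limInd_le hu N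

/-! ### The limit functions -/

lemma tendsto_approx_of_perturbed {x : ℝ} (hx : x ∈ Ico (0 : ℝ) 1) {z : ℕ → ℤ → ℝ} {w : ℤ → ℝ}
    {ρ : ℝ} (hρ : ρ < 1) (hz : ∀ n l, |z n l| ≤ ρ)
    (hzw : ∀ l, Tendsto (fun n => z n l) atTop (𝓝 (w l))) :
    Tendsto (fun n : ℕ => ∑ l ∈ symmResidues (fibQ (2 * (n + 1))),
        convInd (2 * (n + 1)) x l * scaledCot (fibQ (2 * (n + 1))) (l + z n l)) atTop
      (𝓝 (oddSeries (limInd x) + perturbedSeries (limInd x) w)) :=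
  tendsto_sum_scaledCot_perturbed tendsto_fibQ_even (tendsto_convInd x)
    (fun _ _ hN => abs_oddPartialSum_convInd_le hx hN) (fun _ _ => abs_ite_one_zero_le _)
    (fun _ => by simp [convInd]) hρ hz hzw

lemma tendsto_tApprox {x y : ℝ} (hx : x ∈ Ico (0 : ℝ) 1) (hy : |y| < 1) :
    Tendsto (fun n : ℕ => tApprox (2 * n) x y) atTop
      (𝓝 (oddSeries (limInd x) + perturbedSeries (limInd x) fun _ => y)) := by
  rw [← tendsto_add_atTop_iff_nat 1]
  refine (tendsto_approx_of_perturbed hx (z := fun _ _ => y) hy (fun _ _ => le_rfl)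
    (fun _ => tendsto_const_nhds)).congr fun n => ?_
  exact (tApprox_eq_sum (Nat.succ_pos n) hx y).symm

/-- The limiting displacement `y - {l α} / √5` of the nodes of the `s`-function. -/
noncomputable def nodeShift (y : ℝ) (l : ℤ) : ℝ :=
  y - 1 / Real.sqrt 5 * Int.fract (l * goldenAlpha)

lemma tendsto_sApprox {x y : ℝ} (hx : x ∈ Ico (0 : ℝ) 1) (hy : |y| < 1 / 2) :
    Tendsto (fun n : ℕ => sApprox (2 * n) x y) atTop
      (𝓝 (oddSeries (limInd x) + perturbedSeries (limInd x) (nodeShift y))) := by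
  rw [← tendsto_add_atTop_iff_nat 1]
  refine (tendsto_approx_of_perturbed hx (z := fun n l => y - convDefect (2 * (n + 1)) *
    Int.fract (l * fibConv (2 * (n + 1)))) (ρ := |y| + 1 / 2) (by linarith) ?_ ?_).congr
    fun n => (sApprox_eq_sum (Nat.succ_pos n) hx y).symm
  · intro n l
    have h1 := convDefect_even_mem (n + 1)
    have h2 := Int.fract_nonneg ((l : ℝ) * fibConv (2 * (n + 1)))
    have h3 := (Int.fract_lt_one ((l : ℝ) * fibConv (2 * (n + 1)))).le
    refine (abs_sub _ _).trans (add_le_add le_rfl ?_)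
    rw [abs_of_nonneg (mul_nonneg h1.1 h2)]
    nlinarith
  · intro l
    exact ((tendsto_convDefect_even.comp (tendsto_add_atTop_nat 1)).mul
      (tendsto_fract_mul_fibConv l)).const_sub y

lemma abs_nodeShift_le (y : ℝ) (l : ℤ) : |nodeShift y l| ≤ |y| + 1 / 2 := by
  have h2 := Int.fract_nonneg ((l : ℝ) * goldenAlpha)
  have h3 := (Int.fract_lt_one ((l : ℝ) * goldenAlpha)).le
  have h5 := two_lt_sqrt_five
  have h6 : 1 / Real.sqrt 5 ≤ 1 / 2 := one_div_le_one_div_of_le two_pos h5.le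
  have h7 : 0 ≤ 1 / Real.sqrt 5 := by positivity
  refine (abs_sub _ _).trans (add_le_add le_rfl ?_)
  rw [abs_of_nonneg (mul_nonneg h7 h2)]
  nlinarith

lemma limInd_eq_limIndRight {x : ℝ}
    (h : ¬ ∃ m : ℤ, 0 < m ∧ Int.fract (m * goldenAlpha) = x) : limInd x = limIndRight x := by
  funext l
  rw [limInd, limIndRight]
  refine if_congr (and_congr_right fun hl => ?_) rfl rfl
  rw [le_iff_lt_or_eq]
  refine or_congr Iff.rfl ⟨fun h => h.1, fun h' => ⟨h', ?_⟩⟩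
  rcases lt_or_gt_of_ne hl with h1 | h1
  · exact h1
  · exact absurd ⟨l, h1, h'⟩ h

lemma limIndRight_sub_limInd {m : ℤ} (hm : 0 < m) (l : ℤ) :
    limIndRight (Int.fract (m * goldenAlpha)) l - limInd (Int.fract (m * goldenAlpha)) l =
      if l = m then 1 else 0 := by
  rcases eq_or_ne l m with rfl | hlm
  · simp [limIndRight, limInd, hm.ne', hm.le]
  · have hne : Int.fract (l * goldenAlpha) ≠ Int.fract (m * goldenAlpha) :=
      fun h => hlm (fract_int_mul_goldenAlpha_injective h)
    simp [limIndRight, limInd, hlm, hne, le_iff_lt_or_eq]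

/-- The jump of the perturbed series at a point `{m α}`, `m > 0`, of the orbit. -/
lemma perturbedSeries_limIndRight_sub {m : ℤ} (hm : 0 < m) {z : ℤ → ℝ} {ρ : ℝ} (hρ : ρ < 1)
    (hz : ∀ l, |z l| ≤ ρ) :
    perturbedSeries (limIndRight (Int.fract (m * goldenAlpha))) z -
      perturbedSeries (limInd (Int.fract (m * goldenAlpha))) z =
      1 / (Real.pi * (m + z m)) - 1 / (Real.pi * m) := by
  rw [perturbedSeries, perturbedSeries, ← Summable.tsum_sub
    (summable_perturbed (abs_limIndRight_le _) (limIndRight_zero _) hρ hz)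
    (summable_perturbed (abs_limInd_le _) (limInd_zero _) hρ hz), tsum_eq_single m]
  · rw [← sub_mul, limIndRight_sub_limInd hm, if_pos rfl, one_mul]
  · intro l hl
    rw [← sub_mul, limIndRight_sub_limInd hm, if_neg hl, zero_mul]

/-- If the `s`-function is right-continuous at `x`, then `x` is not of the form `{m α}` with
`m > 0`. -/
lemma not_exists_fract_eq_of_isRightContinuousAt {r : ℝ} (hr : 0 < r) {s : ℝ → ℝ → ℝ}
    (hs : IsSFunction r s) {x : ℝ} (hx : x ∈ Ico (0 : ℝ) 1) (hc : IsRightContinuousAt r s x) :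
    ¬ ∃ m : ℤ, 0 < m ∧ Int.fract (m * goldenAlpha) = x := by
  rintro ⟨m, hm, hmx⟩
  -- Any nonzero y within the domain of s and below 1/2 in modulus would do; it is compared with 0.
  set y : ℝ := min r (1 / 2) / 2 with hy
  have hy0 : 0 < y := by rw [hy]; have := lt_min hr (one_half_pos (α := ℝ)); positivity
  have hyr : y < r := by
    have := min_le_left r (1 / 2); rw [hy]; linarith
  have hy2 : y < 1 / 2 := by
    have := min_le_right r (1 / 2); rw [hy]; linarith
  have hlim : ∀ v ∈ Icc (0 : ℝ) y,
      Tendsto (fun u => s u v) (𝓝[>] x) (𝓝 (s x v)) ∧ ∀ u ∈ Ico (0 : ℝ) 1,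
        s u v = oddSeries (limInd u) + perturbedSeries (limInd u) (nodeShift v) := by
    intro v hv
    have hvr : v ∈ Ioo (-r) r := ⟨by linarith [hv.1], hv.2.trans_lt hyr⟩
    refine ⟨(hc v hvr).mono_left (nhdsWithin_mono _ Ioi_subset_Ici_self), fun u hu => ?_⟩
    refine tendsto_nhds_unique (hs u hu v hvr) (tendsto_sApprox hu ?_)
    rw [abs_of_nonneg hv.1]
    exact hv.2.trans_lt hy2
  obtain ⟨hl0, he0⟩ := hlim 0 ⟨le_rfl, hy0.le⟩
  obtain ⟨hl1, he1⟩ := hlim y ⟨hy0.le, le_rfl⟩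
  set ρ : ℝ := y + 1 / 2 with hρdef
  have hρ : ρ < 1 := by linarith
  have hb0 : ∀ l, |nodeShift 0 l| ≤ ρ := fun l => by
    have := abs_nodeShift_le 0 l
    rw [abs_zero] at this
    linarith
  have hb1 : ∀ l, |nodeShift y l| ≤ ρ := fun l => by
    have := abs_nodeShift_le y l
    rwa [abs_of_pos hy0] at this
  have hP (z : ℤ → ℝ) (hz : ∀ l, |z l| ≤ ρ) := tendsto_perturbedSeries (tendsto_limInd_right x)
    (Eventually.of_forall abs_limInd_le) (Eventually.of_forall limInd_zero) hρ hz
  -- Subtracting the value at 0 cancels the odd series, so its jump is never needed.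
  have hdiff : Tendsto (fun u => s u y - s u 0) (𝓝[>] x)
      (𝓝 (perturbedSeries (limIndRight x) (nodeShift y) -
        perturbedSeries (limIndRight x) (nodeShift 0))) := by
    refine ((hP _ hb1).sub (hP _ hb0)).congr' ?_
    filter_upwards [eventually_mem_Ico_right hx] with u hu
    rw [he0 u hu, he1 u hu]
    ring
  have heq := tendsto_nhds_unique hdiff (hl1.sub hl0)
  rw [he0 x hx, he1 x hx] at heq
  have hj0 := perturbedSeries_limIndRight_sub hm hρ hb0
  have hj1 := perturbedSeries_limIndRight_sub hm hρ hb1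
  rw [hmx] at hj0 hj1
  -- Right continuity makes the jumps at y and at 0 agree, yet the two shifts differ by y ≠ 0.
  have hkey : 1 / (Real.pi * (m + nodeShift y m)) = 1 / (Real.pi * (m + nodeShift 0 m)) := by
    linarith
  have hm1 : (1 : ℝ) ≤ m := by exact_mod_cast hm
  have hpos0 := (abs_le.1 (hb0 m)).1
  have hpos1 := (abs_le.1 (hb1 m)).1
  rw [one_div, one_div, inv_inj, mul_right_inj' Real.pi_pos.ne'] at hkey
  unfold nodeShift at hkey
  linarith

theorem mainTheorem7 (r : ℝ) (hr : 0 < r) (s : ℝ → ℝ → ℝ)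
    (hs : IsSFunction r s) (hs_analytic : IsAnalyticInY r s) :
    ∃ t : ℝ → ℝ → ℝ,
      IsTFunction 1 t ∧
      IsAnalyticInY 1 t ∧
      (∀ x ∈ Ico (0 : ℝ) 1, IsRightContinuousAt r s x → IsRightContinuousAt 1 t x) ∧
      ∃ tR : ℝ → ℝ → ℝ,
        (∀ x ∈ Ico (0 : ℝ) 1, ∀ y ∈ Ioo (-1 : ℝ) 1,
          Tendsto (fun u => t u y) (𝓝[>] x) (𝓝 (tR x y))) ∧
        IsAnalyticInY 1 tR ∧
        (∀ x ∈ Ico (0 : ℝ) 1, IsRightContinuousAt 1 tR x) := by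
  have hright : ∀ x ∈ Ico (0 : ℝ) 1, ∀ y ∈ Ioo (-1 : ℝ) 1,
      Tendsto (fun u => oddSeries (limInd u) + perturbedSeries (limInd u) fun _ => y) (𝓝[>] x)
        (𝓝 (oddSeries (limIndRight x) + perturbedSeries (limIndRight x) fun _ => y)) := by
    intro x hx y hy
    exact (tendsto_oddSeries (tendsto_limInd_right x)
      ((eventually_mem_Ico_right hx).mono fun u hu => abs_oddPartialSum_limInd_le hu)).add
      (tendsto_perturbedSeries (tendsto_limInd_right x) (Eventually.of_forall abs_limInd_le)
        (Eventually.of_forall limInd_zero) (abs_lt.2 hy) fun _ => le_rfl)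
  refine ⟨fun x y => oddSeries (limInd x) + perturbedSeries (limInd x) fun _ => y, ?_, ?_, ?_,
    fun x y => oddSeries (limIndRight x) + perturbedSeries (limIndRight x) fun _ => y,
    hright, ?_, ?_⟩
  · exact fun x hx y hy => tendsto_tApprox hx (abs_lt.2 hy)
  · exact fun x _ y hy => analyticAt_const.add
      (analyticAt_perturbedSeries (abs_limInd_le x) (limInd_zero x) hy)
  · intro x hx hc y hy
    -- At such x the value of t is its right limit.
    have heq := limInd_eq_limIndRight (not_exists_fract_eq_of_isRightContinuousAt hr hs hx hc)
    rw [← continuousWithinAt_Ioi_iff_Ici, ContinuousWithinAt]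
    beta_reduce
    rw [heq]
    exact hright x hx y hy
  · exact fun x _ y hy => analyticAt_const.add
      (analyticAt_perturbedSeries (abs_limIndRight_le x) (limIndRight_zero x) hy)
  · intro x hx y hy
    rw [← continuousWithinAt_Ioi_iff_Ici]
    exact (tendsto_oddSeries (tendsto_limIndRight_right x)
      ((eventually_mem_Ico_right hx).mono fun u hu => abs_oddPartialSum_limIndRight_le hu)).add
      (tendsto_perturbedSeries (tendsto_limIndRight_right x)
        (Eventually.of_forall abs_limIndRight_le) (Eventually.of_forall limIndRight_zero)
        (abs_lt.2 hy) fun _ => le_rfl)
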